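/- Let $q\ge 2$ be an integer and let $X$ be (the vertex set of) a $q$-homogeneous tree, i.e. a connected graph without cycles in which every vertex has exactly $q+1$ neighbours. Fix an origin $o\in X$ and write $|x|=d(o,x)$ for the graph distance of $x\in X$ from $o$. A function $f\colon X\to\mathbb{C}$ is called harmonic if $f(v)=\frac{1}{q+1}\sum_{u\sim v}f(u)$ for every $v\in X$. For $\alpha>1$ and $1\le p<\infty$ let $\mathcal{A}^p_\alpha$ be the space of harmonic functions $f$ on $X$ with $$\|f\|_{\mathcal{A}^p_\alpha}=\Big(\sum_{x\in X}|f(x)|^p q^{-\alpha|x|}\Big)^{1/p}<\infty .$$ Let $1<p<\infty$, $\alpha>1$, and let $1<p'<\infty$ be such that $\frac1p+\frac1{p'}=1$. Then $$(\mathcal{A}^p_\alpha)^*=\mathcal{A}^{p'}_\alpha$$ with equivalent norms under the pairing $$\langle f,g\rangle=\sum_{z\in X}f(z)g(z)q^{-\alpha|z|},\qquad f\in\mathcal{A}^p_\alpha,\ g\in\mathcal{A}^{p'}_\alpha .$$ That is: the series defining $\langle f,g\rangle$ converges absolutely for all such $f,g$; the map $g\mapsto\langle\,\cdot\,,g\rangle$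 is a linear bijection of $\mathcal{A}^{p'}_\alpha$ onto the space $(\mathcal{A}^p_\alpha)^*$ of bounded linear functionals on $\mathcal{A}^p_\alpha$; and there are constants $c,C>0$ such that $c\,\|g\|_{\mathcal{A}^{p'}_\alpha}\le\|\langle\,\cdot\,,g\rangle\|_{(\mathcal{A}^p_\alpha)^*}\le C\,\|g\|_{\mathcal{A}^{p'}_\alpha}$ for every $g\in\mathcal{A}^{p'}_\alpha$. -/

import Mathlib

noncomputable section

/-- The combinatorial Laplacian of a complex function `f` on a graph all of whose vertices have
`q + 1` neighbours: `L f (v) = f (v) - (q + 1)⁻¹ * ∑ u ∼ v, f (u)`. -/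
def combinatorialLaplacian {X : Type*} (G : SimpleGraph X) [G.LocallyFinite] (q : ℕ)
    (f : X → ℂ) (v : X) : ℂ :=
  f v - 1 / ((q : ℂ) + 1) * ∑ u ∈ G.neighborFinset v, f u

/-- A function is harmonic if its combinatorial Laplacian vanishes at every vertex. -/
def IsHarmonicFun {X : Type*} (G : SimpleGraph X) [G.LocallyFinite] (q : ℕ) (f : X → ℂ) : Prop :=
  ∀ v, combinatorialLaplacian G q f v = 0

/-- The density `x ↦ q ^ (-α |x|)`, where `|x|` is the graph distance of `x` from the origin `o`. -/
def expWeight {X : Type*} (G : SimpleGraph X) (o : X) (q : ℕ) (α : ℝ) (x : X) : ℝ :=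
  (q : ℝ) ^ (-α * (G.dist o x : ℝ))

theorem expWeight_nonneg {X : Type*} (G : SimpleGraph X) (o : X) (q : ℕ) (α : ℝ) (x : X) :
    0 ≤ expWeight G o q α x :=
  Real.rpow_nonneg (Nat.cast_nonneg q) _

theorem expWeight_pos {X : Type*} (G : SimpleGraph X) (o : X) {q : ℕ} (hq : 2 ≤ q) (α : ℝ)
    (x : X) : 0 < expWeight G o q α x :=
  Real.rpow_pos_of_pos (by exact_mod_cast (by omega : 0 < q)) _

/-- The expression `|f (x)| ^ p * q ^ (-α |x|)` as a `p`-th power. -/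
theorem rpow_mul_expWeight {X : Type*} (G : SimpleGraph X) (o : X) (q : ℕ) (α : ℝ) {p : ℝ}
    (hp : 1 ≤ p) {t : ℝ} (ht : 0 ≤ t) (x : X) :
    t ^ p * expWeight G o q α x = (t * expWeight G o q α x ^ (1 / p)) ^ p := by
  have hw := expWeight_nonneg G o q α x
  rw [Real.mul_rpow ht (Real.rpow_nonneg hw _), ← Real.rpow_mul hw,
    one_div_mul_cancel (by linarith : p ≠ 0), Real.rpow_one]

/-- Minkowski's inequality for the weighted sums. -/
theorem expWeight_minkowski {X : Type*} (G : SimpleGraph X) (o : X) (q : ℕ) (α : ℝ) {p : ℝ}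
    (hp : 1 ≤ p) {f g : X → ℂ}
    (hf : Summable fun x => ‖f x‖ ^ p * expWeight G o q α x)
    (hg : Summable fun x => ‖g x‖ ^ p * expWeight G o q α x) :
    (Summable fun x => ‖f x + g x‖ ^ p * expWeight G o q α x) ∧
      (∑' x, ‖f x + g x‖ ^ p * expWeight G o q α x) ^ (1 / p) ≤
        (∑' x, ‖f x‖ ^ p * expWeight G o q α x) ^ (1 / p) +
          (∑' x, ‖g x‖ ^ p * expWeight G o q α x) ^ (1 / p) := by
  have hw := expWeight_nonneg G o q α
  have hw' : ∀ x, 0 ≤ expWeight G o q α x ^ (1 / p) := fun x => Real.rpow_nonneg (hw x) _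
  have key := Real.Lp_add_le_tsum_of_nonneg (p := p) hp
    (f := fun x => ‖f x‖ * expWeight G o q α x ^ (1 / p))
    (g := fun x => ‖g x‖ * expWeight G o q α x ^ (1 / p))
    (fun x => mul_nonneg (norm_nonneg _) (hw' x)) (fun x => mul_nonneg (norm_nonneg _) (hw' x))
    (by simpa only [rpow_mul_expWeight G o q α hp (norm_nonneg _)] using hf)
    (by simpa only [rpow_mul_expWeight G o q α hp (norm_nonneg _)] using hg)
  simp only [← add_mul] at key
  simp only [← rpow_mul_expWeight G o q α hp (norm_nonneg _),
    ← rpow_mul_expWeight G o q α hp (add_nonneg (norm_nonneg _) (norm_nonneg _))] at key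
  have hle : ∀ x, ‖f x + g x‖ ^ p * expWeight G o q α x ≤
      (‖f x‖ + ‖g x‖) ^ p * expWeight G o q α x := fun x =>
    mul_le_mul_of_nonneg_right
      (Real.rpow_le_rpow (norm_nonneg _) (norm_add_le _ _) (by linarith)) (hw x)
  have h0 : ∀ x, 0 ≤ ‖f x + g x‖ ^ p * expWeight G o q α x := fun x =>
    mul_nonneg (Real.rpow_nonneg (norm_nonneg _) _) (hw x)
  have hs := Summable.of_nonneg_of_le h0 hle key.1
  exact ⟨hs, (Real.rpow_le_rpow (tsum_nonneg h0) (hs.tsum_le_tsum hle key.1)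
    (by positivity)).trans key.2⟩

/-- The complex vector space of harmonic functions with `∑ x, |f (x)| ^ p * q ^ (-α |x|) < ∞`. -/
def bergmanSubmodule {X : Type*} (G : SimpleGraph X) [G.LocallyFinite] (o : X) (q : ℕ) (α : ℝ)
    {p : ℝ} (hp : 1 ≤ p) : Submodule ℂ (X → ℂ) where
  carrier := {f | IsHarmonicFun G q f ∧ Summable fun x => ‖f x‖ ^ p * expWeight G o q α x}
  zero_mem' := by
    refine ⟨fun v => by simp [combinatorialLaplacian], ?_⟩
    simp [Real.zero_rpow (by linarith : p ≠ 0), summable_zero]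
  add_mem' := by
    rintro f g ⟨hf, hf'⟩ ⟨hg, hg'⟩
    refine ⟨fun v => ?_, (expWeight_minkowski G o q α hp hf' hg').1⟩
    have h1 := hf v
    have h2 := hg v
    simp only [combinatorialLaplacian, Pi.add_apply, Finset.sum_add_distrib] at h1 h2 ⊢
    linear_combination h1 + h2
  smul_mem' := by
    rintro c f ⟨hf, hf'⟩
    refine ⟨fun v => ?_, ?_⟩
    · have h1 := hf v
      simp only [combinatorialLaplacian, Pi.smul_apply, smul_eq_mul, ← Finset.mul_sum] at h1 ⊢
      linear_combination c * h1
    · simpa only [Pi.smul_apply, norm_smul, Real.mul_rpow (norm_nonneg _) (norm_nonneg _),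
        mul_assoc] using hf'.mul_left (‖c‖ ^ p)

/-- The harmonic Bergman space with respect to the weight `q ^ (-α |x|)`, for an exponent `p ≥ 1`.
It is a type of its own so that its topology is that of the norm below and not that of
pointwise convergence. -/
def BergmanSpace {X : Type*} (G : SimpleGraph X) [G.LocallyFinite] (o : X) {q : ℕ} (_hq : 2 ≤ q)
    (α : ℝ) {p : ℝ} (hp : 1 ≤ p) : Type _ :=
  ↥(bergmanSubmodule G o q α hp)

namespace BergmanSpace

variable {X : Type*} {G : SimpleGraph X} [G.LocallyFinite] {o : X} {q : ℕ} {hq : 2 ≤ q}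
  {α p : ℝ} {hp : 1 ≤ p}

instance : AddCommGroup (BergmanSpace G o hq α hp) :=
  inferInstanceAs (AddCommGroup ↥(bergmanSubmodule G o q α hp))

instance : Module ℂ (BergmanSpace G o hq α hp) :=
  inferInstanceAs (Module ℂ ↥(bergmanSubmodule G o q α hp))

/-- The elements of the Bergman space are functions on the vertices. -/
instance : CoeFun (BergmanSpace G o hq α hp) (fun _ => X → ℂ) where
  coe f := f.1

/-- The norm `(∑ x, |f (x)| ^ p * q ^ (-α |x|)) ^ (1 / p)`. -/
instance : Norm (BergmanSpace G o hq α hp) where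
  norm f := (∑' x, ‖f x‖ ^ p * expWeight G o q α x) ^ (1 / p)

theorem norm_def (f : BergmanSpace G o hq α hp) :
    ‖f‖ = (∑' x, ‖f x‖ ^ p * expWeight G o q α x) ^ (1 / p) := rfl

theorem term_nonneg (f : BergmanSpace G o hq α hp) (x : X) :
    0 ≤ ‖f x‖ ^ p * expWeight G o q α x :=
  mul_nonneg (Real.rpow_nonneg (norm_nonneg _) _) (expWeight_nonneg G o q α x)

theorem core : NormedSpace.Core ℂ (BergmanSpace G o hq α hp) where
  norm_nonneg f := Real.rpow_nonneg (tsum_nonneg (term_nonneg f)) _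
  norm_smul c f := by
    have h : ∀ x, ‖(c • f) x‖ ^ p * expWeight G o q α x =
        ‖c‖ ^ p * (‖f x‖ ^ p * expWeight G o q α x) := fun x => by
      have hx : (c • f) x = c * f x := rfl
      rw [hx, norm_mul, Real.mul_rpow (norm_nonneg _) (norm_nonneg _), mul_assoc]
    rw [norm_def, norm_def, tsum_congr h, tsum_mul_left,
      Real.mul_rpow (Real.rpow_nonneg (norm_nonneg _) _) (tsum_nonneg (term_nonneg f)),
      ← Real.rpow_mul (norm_nonneg _), mul_one_div_cancel (by linarith : p ≠ 0), Real.rpow_one]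
  norm_triangle f g := (expWeight_minkowski G o q α hp f.2.2 g.2.2).2
  norm_eq_zero_iff f := by
    have hp0 : p ≠ 0 := by linarith
    constructor
    · intro h
      rw [norm_def, Real.rpow_eq_zero (tsum_nonneg (term_nonneg f)) (by positivity)] at h
      have h2 := (hasSum_zero_iff_of_nonneg (term_nonneg f)).1 (h ▸ f.2.2.hasSum)
      refine Subtype.ext (funext fun x => ?_)
      have h3 : ‖f x‖ ^ p * expWeight G o q α x = 0 := congrFun h2 x
      have h4 := (mul_eq_zero.1 h3).resolve_right (expWeight_pos G o hq α x).ne'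
      exact norm_eq_zero.1 ((Real.rpow_eq_zero (norm_nonneg _) hp0).1 h4)
    · rintro rfl
      have h : ∀ x, ‖(0 : BergmanSpace G o hq α hp) x‖ ^ p * expWeight G o q α x = 0 := fun x => by
        have hx : (0 : BergmanSpace G o hq α hp) x = 0 := rfl
        rw [hx, norm_zero, Real.zero_rpow hp0, zero_mul]
      rw [norm_def, tsum_congr h, tsum_zero, Real.zero_rpow (by positivity)]

instance : NormedAddCommGroup (BergmanSpace G o hq α hp) := NormedAddCommGroup.ofCore core

instance : NormedSpace ℂ (BergmanSpace G o hq α hp) := NormedSpace.ofCore core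

end BergmanSpace

end

/-! Write `S u = u ∘ parent`, with value 0 at the root, and `a = q ^ (-α)`. Split a harmonic
function into its value at `o` and a part `f` vanishing there, and encode `f` by its innovations `d
= (1 - q⁻¹ S)(1 - S) f`. The mean value property at `y` says exactly that `d` sums to zero over the
children of `y` (`sum_children_innovation`), so harmonicity becomes a condition on each set of
siblings separately.

On functions vanishing at the root, `S` scales the weighted `ℓ^p` norm by at most `(q a) ^ (1 / p)`,
which is less than 1 because `α > 1`. Hence `1 - S` and `1 - q⁻¹ S` have bounded inverses there
(`wMem_of_eq_add_shift`), and the harmonic functions with `f o = 0` correspond boundedly to the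
sibling-sum-zero functions vanishing at `o`. Subtracting sibling averages projects boundedly onto
functions with zero sibling sums (`wMem_siblingProj`).

The pairing respects this encoding. A sibling-sum-zero function is orthogonal to every shift, since
shifts are constant on siblings, and `⟨S u, S v⟩ = q a ⟨u, v⟩` if `u o = 0`. These two facts give
`⟨f, g⟩ = κ ⟨d_f, d_g⟩` with an explicit `κ ≠ 0` (`wPair_eq_innovation`) and make constants
orthogonal to harmonic functions vanishing at `o` (`wPair_one_eq_zero`).

The duality thus descends from weighted `ℓ^p`: pull a functional back to `ℓ^p`, represent it there
by some `h`, project `h`, and rebuild a harmonic function (`exists_pairing_eq`). Injectivity is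
surjectivity with the exponents exchanged. -/

noncomputable section

/-! ### Rooted trees: parents and children. -/

namespace SimpleGraph

variable {X : Type*} {G : SimpleGraph X}

theorem IsTree.dist_adj (hG : G.IsTree) (o : X) {u v : X} (h : G.Adj u v) :
    G.dist o v = G.dist o u + 1 ∨ G.dist o u = G.dist o v + 1 := by
  have := hG.dist_ne_of_adj o h
  rcases h.diff_dist_adj (u := o) with h | h | h <;> omega

/-- Geodesics to `u` and to `v`, each extended by one edge, are paths from `o` to `x`. A tree has
only one such path, so the penultimate vertices agree. -/
theorem IsTree.eq_of_adj_of_dist (hG : G.IsTree) {o u v x : X} (hu : G.Adj u x) (hv : G.Adj v x)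
    (hu' : G.dist o u + 1 = G.dist o x) (hv' : G.dist o v + 1 = G.dist o x) : u = v := by
  obtain ⟨p, hp, hpl⟩ := hG.connected.exists_path_of_dist o u
  obtain ⟨r, hr, hrl⟩ := hG.connected.exists_path_of_dist o v
  have h1 := (p.concat hu).isPath_of_length_eq_dist (by rw [Walk.length_concat]; omega)
  have h2 := (r.concat hv).isPath_of_length_eq_dist (by rw [Walk.length_concat]; omega)
  have h3 := congrArg Walk.penultimate ((hG.existsUnique_path o x).unique h1 h2)
  simpa using h3

theorem Connected.exists_adj_dist (hG : G.Connected) {o x : X} (hx : x ≠ o) :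
    ∃ u, G.Adj u x ∧ G.dist o u + 1 = G.dist o x := by
  obtain ⟨p, hp, hpl⟩ := hG.exists_path_of_dist o x
  have hn : ¬ p.Nil := fun h => hx h.eq.symm
  refine ⟨p.penultimate, p.adj_penultimate hn, ?_⟩
  have h1 : G.dist o p.penultimate ≤ p.dropLast.length := dist_le _
  have h2 := hG.dist_triangle (u := o) (v := p.penultimate) (w := x)
  rw [dist_eq_one_iff_adj.2 (p.adj_penultimate hn)] at h2
  have h3 : p.dropLast.length + 1 = p.length := by
    rw [← Walk.length_concat p.dropLast (p.adj_penultimate hn), Walk.concat_dropLast]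
  omega

open scoped Classical in
/-- The neighbour of `x` that is closer to the root `o`; the root is its own parent. -/
def parent (G : SimpleGraph X) (o x : X) : X :=
  if h : ∃ u, G.Adj u x ∧ G.dist o u + 1 = G.dist o x then h.choose else x

open scoped Classical in
/-- The neighbours of `v` that are farther from the root `o`. -/
def children (G : SimpleGraph X) [G.LocallyFinite] (o v : X) : Finset X :=
  (G.neighborFinset v).filter fun u => G.dist o u = G.dist o v + 1

variable {o : X}

theorem IsTree.adj_parent (hG : G.IsTree) {x : X} (hx : x ≠ o) : G.Adj (G.parent o x) x := by
  have h := hG.connected.exists_adj_dist hx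
  rw [parent, dif_pos h]
  exact h.choose_spec.1

theorem IsTree.dist_parent (hG : G.IsTree) {x : X} (hx : x ≠ o) :
    G.dist o (G.parent o x) + 1 = G.dist o x := by
  have h := hG.connected.exists_adj_dist hx
  rw [parent, dif_pos h]
  exact h.choose_spec.2

variable [G.LocallyFinite]

theorem IsTree.mem_children (hG : G.IsTree) {u v : X} :
    u ∈ G.children o v ↔ u ≠ o ∧ G.parent o u = v := by
  rw [children, Finset.mem_filter, mem_neighborFinset]
  constructor
  · rintro ⟨h1, h2⟩
    have hu : u ≠ o := by
      rintro rfl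
      simp at h2
    exact ⟨hu, hG.eq_of_adj_of_dist (hG.adj_parent hu) h1 (hG.dist_parent hu) h2.symm⟩
  · rintro ⟨h1, rfl⟩
    exact ⟨hG.adj_parent h1, (hG.dist_parent h1).symm⟩

theorem neighborFinset_root : G.neighborFinset o = G.children o o := by
  ext u
  rw [children, Finset.mem_filter, mem_neighborFinset]
  refine ⟨fun h => ⟨h, ?_⟩, fun h => h.1⟩
  rw [dist_eq_one_iff_adj.2 h, dist_self]

theorem IsTree.parent_notMem_children (hG : G.IsTree) {v : X} (hv : v ≠ o) :
    G.parent o v ∉ G.children o v := by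
  rw [children, Finset.mem_filter]
  rintro ⟨-, h⟩
  have := hG.dist_parent hv
  omega

theorem IsTree.neighborFinset_eq_cons (hG : G.IsTree) {v : X} (hv : v ≠ o) :
    G.neighborFinset v =
      Finset.cons (G.parent o v) (G.children o v) (hG.parent_notMem_children hv) := by
  ext u
  rw [Finset.mem_cons, mem_neighborFinset, hG.mem_children]
  constructor
  · intro h
    rcases hG.dist_adj o h with h1 | h1
    · right
      rw [← hG.mem_children, children, Finset.mem_filter, mem_neighborFinset]
      exact ⟨h, h1⟩
    · left
      exact hG.eq_of_adj_of_dist h.symm (hG.adj_parent hv) h1.symm (hG.dist_parent hv)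
  · rintro (rfl | ⟨h1, rfl⟩)
    · exact (hG.adj_parent hv).symm
    · exact hG.adj_parent h1

theorem card_children_root {q : ℕ} (hreg : G.IsRegularOfDegree (q + 1)) :
    (G.children o o).card = q + 1 := by
  rw [← neighborFinset_root, card_neighborFinset_eq_degree, hreg o]

theorem IsTree.card_children (hG : G.IsTree) {q : ℕ} (hreg : G.IsRegularOfDegree (q + 1))
    {v : X} (hv : v ≠ o) : (G.children o v).card = q := by
  have h := hreg v
  rw [← card_neighborFinset_eq_degree, hG.neighborFinset_eq_cons hv, Finset.card_cons] at h
  omega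

theorem IsTree.card_children_le (hG : G.IsTree) {q : ℕ} (hreg : G.IsRegularOfDegree (q + 1))
    (v : X) : (G.children o v).card ≤ q + 1 := by
  by_cases hv : v = o
  · rw [hv, card_children_root hreg]
  · rw [hG.card_children hreg hv]
    omega

end SimpleGraph

/-! ### Weighted `ℓ^p`: Minkowski, Hölder and the bilinear pairing. -/

section WeightedLp

variable {X : Type*}

/-- The sum `∑ x, |f (x)| ^ p * w (x)` is finite. -/
def WMem (w : X → ℝ) (p : ℝ) (f : X → ℂ) : Prop := Summable fun x => ‖f x‖ ^ p * w x

/-- The weighted norm `(∑ x, |f (x)| ^ p * w (x)) ^ (1 / p)`. -/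
def wNorm (w : X → ℝ) (p : ℝ) (f : X → ℂ) : ℝ := (∑' x, ‖f x‖ ^ p * w x) ^ (1 / p)

variable {w : X → ℝ} {p p' : ℝ} {f g : X → ℂ}

theorem wterm_nonneg (hw : ∀ x, 0 ≤ w x) (f : X → ℂ) (x : X) : 0 ≤ ‖f x‖ ^ p * w x :=
  mul_nonneg (Real.rpow_nonneg (norm_nonneg _) _) (hw x)

theorem wNorm_nonneg (hw : ∀ x, 0 ≤ w x) : 0 ≤ wNorm w p f :=
  Real.rpow_nonneg (tsum_nonneg (wterm_nonneg hw f)) _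

theorem wNorm_rpow (hw : ∀ x, 0 ≤ w x) (hp : 1 ≤ p) :
    wNorm w p f ^ p = ∑' x, ‖f x‖ ^ p * w x := by
  rw [wNorm, ← Real.rpow_mul (tsum_nonneg (wterm_nonneg hw f)),
    one_div_mul_cancel (by linarith : p ≠ 0), Real.rpow_one]

theorem wNorm_le_of_tsum_le (hw : ∀ x, 0 ≤ w x) (hp : 1 ≤ p) {C : ℝ} (hC : 0 ≤ C)
    (h : ∑' x, ‖f x‖ ^ p * w x ≤ C ^ p) : wNorm w p f ≤ C := by
  have h1 := Real.rpow_le_rpow (tsum_nonneg (wterm_nonneg hw f)) h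
    (by positivity : 0 ≤ 1 / p)
  rwa [← Real.rpow_mul hC, mul_one_div_cancel (by linarith : p ≠ 0), Real.rpow_one] at h1

theorem wterm_eq (hw : ∀ x, 0 ≤ w x) (hp : 1 ≤ p) {t : ℝ} (ht : 0 ≤ t) (x : X) :
    t ^ p * w x = (t * w x ^ (1 / p)) ^ p := by
  rw [Real.mul_rpow ht (Real.rpow_nonneg (hw x) _), ← Real.rpow_mul (hw x),
    one_div_mul_cancel (by linarith : p ≠ 0), Real.rpow_one]

theorem WMem.mono (hw : ∀ x, 0 ≤ w x) (hp : 1 ≤ p) (hg : WMem w p g)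
    (h : ∀ x, ‖f x‖ ≤ ‖g x‖) : WMem w p f ∧ wNorm w p f ≤ wNorm w p g := by
  have hle : ∀ x, ‖f x‖ ^ p * w x ≤ ‖g x‖ ^ p * w x := fun x =>
    mul_le_mul_of_nonneg_right
      (Real.rpow_le_rpow (norm_nonneg _) (h x) (by linarith)) (hw x)
  have hs : WMem w p f := Summable.of_nonneg_of_le (wterm_nonneg hw f) hle hg
  exact ⟨hs, Real.rpow_le_rpow (tsum_nonneg (wterm_nonneg hw f)) (hs.tsum_le_tsum hle hg)
    (by positivity)⟩

theorem WMem.add (hw : ∀ x, 0 ≤ w x) (hp : 1 ≤ p) (hf : WMem w p f) (hg : WMem w p g) :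
    WMem w p (f + g) ∧ wNorm w p (f + g) ≤ wNorm w p f + wNorm w p g := by
  have hw' : ∀ x, 0 ≤ w x ^ (1 / p) := fun x => Real.rpow_nonneg (hw x) _
  have key := Real.Lp_add_le_tsum_of_nonneg (p := p) hp
    (f := fun x => ‖f x‖ * w x ^ (1 / p)) (g := fun x => ‖g x‖ * w x ^ (1 / p))
    (fun x => mul_nonneg (norm_nonneg _) (hw' x)) (fun x => mul_nonneg (norm_nonneg _) (hw' x))
    (by simpa only [WMem, ← wterm_eq hw hp (norm_nonneg _)] using hf)
    (by simpa only [WMem, ← wterm_eq hw hp (norm_nonneg _)] using hg)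
  simp only [← add_mul] at key
  simp only [← wterm_eq hw hp (norm_nonneg _),
    ← wterm_eq hw hp (add_nonneg (norm_nonneg _) (norm_nonneg _))] at key
  have hle : ∀ x, ‖(f + g) x‖ ^ p * w x ≤ (‖f x‖ + ‖g x‖) ^ p * w x := fun x =>
    mul_le_mul_of_nonneg_right
      (Real.rpow_le_rpow (norm_nonneg _) (norm_add_le _ _) (by linarith)) (hw x)
  have hs : WMem w p (f + g) := Summable.of_nonneg_of_le (wterm_nonneg hw _) hle key.1
  exact ⟨hs, (Real.rpow_le_rpow (tsum_nonneg (wterm_nonneg hw _)) (hs.tsum_le_tsum hle key.1)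
    (by positivity)).trans key.2⟩

theorem WMem.smul (hw : ∀ x, 0 ≤ w x) (hp : 1 ≤ p) (c : ℂ) (hf : WMem w p f) :
    WMem w p (c • f) ∧ wNorm w p (c • f) = ‖c‖ * wNorm w p f := by
  have h : ∀ x, ‖(c • f) x‖ ^ p * w x = ‖c‖ ^ p * (‖f x‖ ^ p * w x) := fun x => by
    rw [Pi.smul_apply, norm_smul, Real.mul_rpow (norm_nonneg _) (norm_nonneg _), mul_assoc]
  constructor
  · simpa only [WMem, h] using Summable.mul_left (‖c‖ ^ p) hf
  · rw [wNorm, wNorm, tsum_congr h, tsum_mul_left,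
      Real.mul_rpow (Real.rpow_nonneg (norm_nonneg _) _) (tsum_nonneg (wterm_nonneg hw f)),
      ← Real.rpow_mul (norm_nonneg _), mul_one_div_cancel (by linarith : p ≠ 0), Real.rpow_one]

theorem WMem.sub (hw : ∀ x, 0 ≤ w x) (hp : 1 ≤ p) (hf : WMem w p f) (hg : WMem w p g) :
    WMem w p (f - g) ∧ wNorm w p (f - g) ≤ wNorm w p f + wNorm w p g := by
  have h := hg.smul hw hp (-1)
  have h2 := hf.add hw hp h.1
  rw [h.2, norm_neg, norm_one, one_mul, neg_one_smul, ← sub_eq_add_neg] at h2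
  exact h2

theorem WMem.of_finite (hp : 1 ≤ p) (s : Finset X) (h : ∀ x ∉ s, f x = 0) : WMem w p f := by
  refine summable_of_ne_finset_zero (s := s) fun x hx => ?_
  rw [h x hx, norm_zero, Real.zero_rpow (by linarith : p ≠ 0), zero_mul]

theorem WMem.of_forall_sum_le (hw : ∀ x, 0 ≤ w x) (hp : 1 ≤ p) {C : ℝ} (hC : 0 ≤ C)
    (h : ∀ s : Finset X, ∑ x ∈ s, ‖f x‖ ^ p * w x ≤ C ^ p) : WMem w p f ∧ wNorm w p f ≤ C := by
  have hs : WMem w p f := summable_of_sum_le (wterm_nonneg hw f) h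
  exact ⟨hs, wNorm_le_of_tsum_le hw hp hC (hs.tsum_le_of_sum_le h)⟩

/-- The bilinear pairing `∑ x, f (x) * g (x) * w (x)`. -/
def wPair (w : X → ℝ) (f g : X → ℂ) : ℂ := ∑' x, f x * g x * (w x : ℂ)

theorem wPair_comm (f g : X → ℂ) : wPair w f g = wPair w g f :=
  tsum_congr fun x => by ring

/-- Hölder's inequality after splitting the weight as `w ^ (1 / p) * w ^ (1 / p')`. -/
theorem WMem.hasSum_pair (hw : ∀ x, 0 ≤ w x) (hpp : p.HolderConjugate p')
    (hf : WMem w p f) (hg : WMem w p' g) :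
    Summable (fun x => ‖f x * g x * (w x : ℂ)‖) ∧
    HasSum (fun x => f x * g x * (w x : ℂ)) (wPair w f g) ∧
      ‖wPair w f g‖ ≤ wNorm w p f * wNorm w p' g := by
  have hp : 1 ≤ p := hpp.lt.le
  have hp' : 1 ≤ p' := hpp.symm.lt.le
  have hw' : ∀ (s : ℝ) x, 0 ≤ w x ^ s := fun s x => Real.rpow_nonneg (hw x) _
  obtain ⟨h1, h2⟩ := Real.summable_and_inner_le_Lp_mul_Lq_tsum_of_nonneg hpp
    (f := fun x => ‖f x‖ * w x ^ (1 / p)) (g := fun x => ‖g x‖ * w x ^ (1 / p'))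
    (fun x => mul_nonneg (norm_nonneg _) (hw' _ x)) (fun x => mul_nonneg (norm_nonneg _) (hw' _ x))
    (by simpa only [WMem, ← wterm_eq hw hp (norm_nonneg _)] using hf)
    (by simpa only [WMem, ← wterm_eq hw hp' (norm_nonneg _)] using hg)
  simp only [← wterm_eq hw hp (norm_nonneg _), ← wterm_eq hw hp' (norm_nonneg _)] at h2
  have he : ∀ x, ‖f x * g x * (w x : ℂ)‖ = ‖f x‖ * w x ^ (1 / p) * (‖g x‖ * w x ^ (1 / p')) := by
    intro x
    have h3 : w x ^ (1 / p) * w x ^ (1 / p') = w x := by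
      rw [← Real.rpow_add_of_nonneg (hw x) (by positivity) (by positivity), one_div, one_div,
        hpp.inv_add_inv_eq_one, Real.rpow_one]
    rw [norm_mul, norm_mul, Complex.norm_of_nonneg (hw x)]
    calc _ = ‖f x‖ * ‖g x‖ * (w x ^ (1 / p) * w x ^ (1 / p')) := by rw [h3]
      _ = _ := by ring
  have hs : Summable fun x => ‖f x * g x * (w x : ℂ)‖ := by simpa only [he] using h1
  refine ⟨hs, hs.of_norm.hasSum, (norm_tsum_le_tsum_norm hs).trans ?_⟩
  rw [tsum_congr he]
  exact h2

theorem WMem.pair_add (hw : ∀ x, 0 ≤ w x) (hpp : p.HolderConjugate p') {f₁ f₂ : X → ℂ}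
    (hf : WMem w p f₁) (hf' : WMem w p f₂) (hg : WMem w p' g) :
    wPair w (f₁ + f₂) g = wPair w f₁ g + wPair w f₂ g := by
  rw [wPair, wPair, wPair, ← (hf.hasSum_pair hw hpp hg).2.1.summable.tsum_add
    (hf'.hasSum_pair hw hpp hg).2.1.summable]
  exact tsum_congr fun x => by rw [Pi.add_apply]; ring

theorem wPair_smul (c : ℂ) (f g : X → ℂ) : wPair w (c • f) g = c * wPair w f g := by
  rw [wPair, wPair, ← tsum_mul_left]
  exact tsum_congr fun x => by rw [Pi.smul_apply, smul_eq_mul]; ring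

end WeightedLp

/-! ### The shift, and summation over siblings. -/

namespace SimpleGraph

variable {X : Type*} {G : SimpleGraph X} {o : X}

open scoped Classical in
/-- The shift `u ↦ u ∘ parent`, with value `0` at the root. -/
def shift (G : SimpleGraph X) (o : X) : (X → ℂ) →ₗ[ℂ] (X → ℂ) where
  toFun u x := if x = o then 0 else u (G.parent o x)
  map_add' u v := by
    ext x
    by_cases h : x = o <;> simp [h]
  map_smul' c u := by
    ext x
    by_cases h : x = o <;> simp [h]

theorem shift_root (u : X → ℂ) : G.shift o u o = 0 := if_pos rfl

theorem shift_apply (u : X → ℂ) {x : X} (hx : x ≠ o) : G.shift o u x = u (G.parent o x) :=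
  if_neg hx

variable [G.LocallyFinite]

/-- The fibres of `parent` are the sets of children, except that the root, being its own parent,
also lies in the fibre over itself; `h0` removes its contribution. -/
theorem IsTree.hasSum_fiber {E : Type*} [AddCommMonoid E] [TopologicalSpace E]
    (hG : G.IsTree) {H : X → E} (h0 : H o = 0) (y : X) :
    HasSum (fun c : {x // G.parent o x = y} => H c) (∑ x ∈ G.children o y, H x) := by
  classical
  refine (hasSum_subtype_iff_indicator (s := {x | G.parent o x = y})).2 ?_
  have h1 : ∑ x ∈ G.children o y, H x =
      ∑ x ∈ G.children o y, {x | G.parent o x = y}.indicator H x :=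
    Finset.sum_congr rfl fun x hx => by
      rw [Set.indicator_of_mem]
      exact (hG.mem_children.1 hx).2
  rw [h1]
  refine hasSum_sum_of_ne_finset_zero fun x hx => ?_
  by_cases hxo : x = o
  · rw [Set.indicator_apply]
    simp [hxo, h0]
  · rw [Set.indicator_of_notMem]
    intro hm
    exact hx (hG.mem_children.2 ⟨hxo, hm⟩)

theorem IsTree.hasSum_children {E : Type*} [NormedAddCommGroup E]
    (hG : G.IsTree) {H : X → E} (h0 : H o = 0) {a : E} (hs : HasSum H a) :
    HasSum (fun y => ∑ x ∈ G.children o y, H x) a :=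
  HasSum.sigma ((Equiv.sigmaFiberEquiv (G.parent o)).hasSum_iff.2 hs)
    fun y => hG.hasSum_fiber h0 y

theorem IsTree.summable_of_children (hG : G.IsTree) {H : X → ℝ} (h0 : H o = 0)
    (hn : ∀ x, 0 ≤ H x) (hs : Summable fun y => ∑ x ∈ G.children o y, H x) : Summable H := by
  rw [← (Equiv.sigmaFiberEquiv (G.parent o)).summable_iff]
  refine (summable_sigma_of_nonneg fun c => hn _).2 ⟨fun y => (hG.hasSum_fiber h0 y).summable, ?_⟩
  convert hs with y
  exact (hG.hasSum_fiber h0 y).tsum_eq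

end SimpleGraph

/-- A `(q + 1)`-regular tree with root `o` and a weight `w` that is multiplied by `a < 1 / q` in
each step away from the root. -/
structure TreeWeight {X : Type*} (G : SimpleGraph X) [G.LocallyFinite] (o : X) (q : ℕ) (a : ℝ)
    (w : X → ℝ) : Prop where
  tree : G.IsTree
  reg : G.IsRegularOfDegree (q + 1)
  one_lt : 1 < q
  root : w o = 1
  pos : ∀ x, 0 < w x
  step : ∀ x, x ≠ o → w x = a * w (G.parent o x)
  ratio_pos : 0 < a
  mul_lt_one : q * a < 1

/-! ### The shift on weighted `ℓ^p`. -/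

namespace TreeWeight

variable {X : Type*} {G : SimpleGraph X} [G.LocallyFinite] {o : X} {q : ℕ} {a : ℝ} {w : X → ℝ}
  {p p' : ℝ}

theorem nonneg (T : TreeWeight G o q a w) (x : X) : 0 ≤ w x := (T.pos x).le

theorem q_pos (T : TreeWeight G o q a w) : (0 : ℝ) < q := by
  exact_mod_cast zero_lt_one.trans T.one_lt

theorem step_children (T : TreeWeight G o q a w) {x y : X} (hx : x ∈ G.children o y) :
    w x = a * w y := by
  obtain ⟨h1, rfl⟩ := T.tree.mem_children.1 hx
  exact T.step x h1

theorem shift_children (T : TreeWeight G o q a w) {x y : X} (hx : x ∈ G.children o y)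
    (u : X → ℂ) : G.shift o u x = u y := by
  obtain ⟨h1, rfl⟩ := T.tree.mem_children.1 hx
  exact SimpleGraph.shift_apply u h1

/-- Grouping by parents, each child of `y` contributes `a * (‖u y‖ ^ p * w y)`. The alternative `u y
= 0` allows `M = q` although the root has `q + 1` children. -/
theorem wMem_shift_of_card_le (T : TreeWeight G o q a w) (hp : 1 ≤ p) {u : X → ℂ} {M : ℝ}
    (hu : WMem w p u) (hM : 0 ≤ M) (hc : ∀ y, u y = 0 ∨ ((G.children o y).card : ℝ) ≤ M) :
    WMem w p (G.shift o u) ∧ wNorm w p (G.shift o u) ≤ (M * a) ^ (1 / p) * wNorm w p u := by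
  have hp0 : p ≠ 0 := by linarith
  have h0 : ‖G.shift o u o‖ ^ p * w o = 0 := by
    rw [SimpleGraph.shift_root, norm_zero, Real.zero_rpow hp0, zero_mul]
  have he : ∀ y, ∑ x ∈ G.children o y, ‖G.shift o u x‖ ^ p * w x =
      (G.children o y).card * (a * (‖u y‖ ^ p * w y)) := fun y => by
    rw [← nsmul_eq_mul, ← Finset.sum_const]
    refine Finset.sum_congr rfl fun x hx => ?_
    rw [T.shift_children hx, T.step_children hx]
    ring
  have hle : ∀ y, ((G.children o y).card : ℝ) * (a * (‖u y‖ ^ p * w y)) ≤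
      M * a * (‖u y‖ ^ p * w y) := fun y => by
    rcases hc y with h | h
    · rw [h, norm_zero, Real.zero_rpow hp0]
      simp
    · rw [mul_assoc]
      exact mul_le_mul_of_nonneg_right h
        (mul_nonneg T.ratio_pos.le (wterm_nonneg T.nonneg u y))
  have hsM : Summable fun y => M * a * (‖u y‖ ^ p * w y) := Summable.mul_left _ hu
  have hs1 : Summable fun y => ∑ x ∈ G.children o y, ‖G.shift o u x‖ ^ p * w x := by
    refine Summable.of_nonneg_of_le
      (fun y => Finset.sum_nonneg fun x _ => wterm_nonneg T.nonneg _ x) (fun y => ?_) hsM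
    rw [he]
    exact hle y
  have hs : WMem w p (G.shift o u) :=
    T.tree.summable_of_children h0 (wterm_nonneg T.nonneg _) hs1
  refine ⟨hs, wNorm_le_of_tsum_le T.nonneg hp
    (mul_nonneg (Real.rpow_nonneg (mul_nonneg hM T.ratio_pos.le) _) (wNorm_nonneg T.nonneg)) ?_⟩
  rw [Real.mul_rpow (Real.rpow_nonneg (mul_nonneg hM T.ratio_pos.le) _) (wNorm_nonneg T.nonneg),
    ← Real.rpow_mul (mul_nonneg hM T.ratio_pos.le), one_div_mul_cancel hp0, Real.rpow_one,
    wNorm_rpow T.nonneg hp, ← tsum_mul_left, ← (T.tree.hasSum_children h0 hs.hasSum).tsum_eq]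
  exact hs1.tsum_le_tsum (fun y => by rw [he]; exact hle y) hsM

theorem wMem_shift (T : TreeWeight G o q a w) (hp : 1 ≤ p) {u : X → ℂ} (hu : WMem w p u) :
    WMem w p (G.shift o u) ∧
      wNorm w p (G.shift o u) ≤ ((q + 1) * a) ^ (1 / p) * wNorm w p u :=
  T.wMem_shift_of_card_le hp hu (by positivity) fun y =>
    Or.inr (by exact_mod_cast T.tree.card_children_le T.reg y)

theorem wMem_shift_of_root (T : TreeWeight G o q a w) (hp : 1 ≤ p) {u : X → ℂ}
    (hu : WMem w p u) (h0 : u o = 0) :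
    WMem w p (G.shift o u) ∧ wNorm w p (G.shift o u) ≤ (q * a) ^ (1 / p) * wNorm w p u := by
  refine T.wMem_shift_of_card_le hp hu (by positivity) fun y => ?_
  by_cases hy : y = o
  · left
    rw [hy, h0]
  · right
    rw [T.tree.card_children T.reg hy]

theorem wPair_shift_shift (T : TreeWeight G o q a w) (hpp : p.HolderConjugate p') {u v : X → ℂ}
    (hu : WMem w p u) (hv : WMem w p' v) (h0 : u o = 0) :
    wPair w (G.shift o u) (G.shift o v) = q * a * wPair w u v := by
  have hs := ((T.wMem_shift hpp.lt.le hu).1.hasSum_pair T.nonneg hpp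
    (T.wMem_shift hpp.symm.lt.le hv).1).2.1
  have h := T.tree.hasSum_children (o := o) (by simp [SimpleGraph.shift_root]) hs
  have h2 := (hu.hasSum_pair T.nonneg hpp hv).2.1.mul_left ((q : ℂ) * a)
  refine (h.tsum_eq.symm.trans (tsum_congr fun y => ?_)).trans h2.tsum_eq
  have h3 : ∀ x ∈ G.children o y, G.shift o u x * G.shift o v x * (w x : ℂ) =
      u y * v y * (a * w y : ℝ) := fun x hx => by
    rw [T.shift_children hx, T.shift_children hx, T.step_children hx]
  rw [Finset.sum_congr rfl h3, Finset.sum_const, nsmul_eq_mul]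
  by_cases hy : y = o
  · rw [hy, h0]
    ring
  · rw [T.tree.card_children T.reg hy]
    push_cast
    ring

/-- Both the weight and a shifted function are constant on siblings, so each sibling group
contributes a multiple of the sum of `d` over it. -/
theorem wPair_shift_eq_zero (T : TreeWeight G o q a w) (hpp : p.HolderConjugate p')
    {d v : X → ℂ} (hd : WMem w p d) (hv : WMem w p' v) (h0 : d o = 0)
    (hc : ∀ y, ∑ x ∈ G.children o y, d x = 0) : wPair w d (G.shift o v) = 0 := by
  have hs := (hd.hasSum_pair T.nonneg hpp (T.wMem_shift hpp.symm.lt.le hv).1).2.1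
  have h := T.tree.hasSum_children (o := o) (by simp [h0]) hs
  refine h.unique ?_
  convert hasSum_zero with y
  have h3 : ∀ x ∈ G.children o y, d x * G.shift o v x * (w x : ℂ) =
      d x * (v y * (a * w y : ℝ)) := fun x hx => by
    rw [T.shift_children hx, T.step_children hx]
    ring
  rw [Finset.sum_congr rfl h3, ← Finset.sum_mul, hc, zero_mul]

/-- The contraction factor of the shift. -/
theorem factor_lt_one (T : TreeWeight G o q a w) (hp : 1 ≤ p) : (q * a) ^ (1 / p) < 1 :=
  Real.rpow_lt_one (mul_nonneg T.q_pos.le T.ratio_pos.le) T.mul_lt_one (by positivity)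

/-- A solution of `u = e + c • shift u` is bounded by `e` if `‖c‖ ≤ 1`. -/
theorem wMem_of_eq_add_shift (T : TreeWeight G o q a w) (hp : 1 ≤ p) {u e : X → ℂ} {c : ℂ}
    (hc : ‖c‖ ≤ 1) (he : WMem w p e) (h0 : u o = 0) (hu : u = e + c • G.shift o u) :
    WMem w p u ∧ wNorm w p u ≤ (1 - (q * a) ^ (1 / p))⁻¹ * wNorm w p e := by
  set ρ : ℝ := (q * a) ^ (1 / p)
  have hρ : ρ < 1 := T.factor_lt_one hp
  have hρ0 : 0 ≤ ρ := Real.rpow_nonneg (mul_nonneg T.q_pos.le T.ratio_pos.le) _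
  have hN : 0 ≤ wNorm w p e := wNorm_nonneg T.nonneg
  have hK : 0 ≤ (1 - ρ)⁻¹ * wNorm w p e := mul_nonneg (inv_nonneg.2 (by linarith)) hN
  -- Membership of `u` is not known in advance, so the bound is proved for truncations to balls,
  -- uniformly in the radius.
  let t : ℕ → X → ℂ := fun n x => if G.dist o x ≤ n then u x else 0
  have ht : ∀ n, WMem w p (t n) ∧ wNorm w p (t n) ≤ (1 - ρ)⁻¹ * wNorm w p e := by
    intro n
    induction n with
    | zero =>
      have : t 0 = 0 := by
        ext x
        by_cases hx : x = o
        · simp [t, hx, h0]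
        · have := T.tree.dist_parent hx
          simp only [t]
          rw [if_neg (by omega)]
          rfl
      rw [this]
      have hz := WMem.of_finite (w := w) (f := (0 : X → ℂ)) hp ∅ fun x _ => rfl
      refine ⟨hz, ?_⟩
      have h2 := (hz.smul T.nonneg hp 0).2
      rw [zero_smul, norm_zero, zero_mul] at h2
      rwa [h2]
    | succ n ih =>
      have h1 := T.wMem_shift_of_root hp ih.1 (by simp [t, h0])
      have h2 := h1.1.smul T.nonneg hp c
      have h3 := he.add T.nonneg hp h2.1
      -- Parents of vertices in the ball of radius `n + 1` lie in the ball of radius `n`, so `t (n +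
      -- 1)` is dominated by `e + c • shift (t n)`.
      have h4 := h3.1.mono T.nonneg hp (f := t (n + 1)) (by
        intro x
        simp only [t]
        split_ifs with hx
        · by_cases hxo : x = o
          · rw [hxo, h0, norm_zero]
            exact norm_nonneg _
          · refine le_of_eq (congrArg _ ?_)
            conv_lhs => rw [hu]
            have := T.tree.dist_parent hxo
            simp only [Pi.add_apply, Pi.smul_apply, SimpleGraph.shift_apply _ hxo]
            rw [if_pos (by omega)]
        · rw [norm_zero]
          exact norm_nonneg _)
      refine ⟨h4.1, h4.2.trans (h3.2.trans ?_)⟩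
      rw [h2.2]
      have h5 : ‖c‖ * wNorm w p (G.shift o (t n)) ≤ ρ * ((1 - ρ)⁻¹ * wNorm w p e) :=
        calc _ ≤ 1 * wNorm w p (G.shift o (t n)) :=
              mul_le_mul_of_nonneg_right hc (wNorm_nonneg T.nonneg)
          _ ≤ ρ * wNorm w p (t n) := by rw [one_mul]; exact h1.2
          _ ≤ _ := mul_le_mul_of_nonneg_left ih.2 hρ0
      have h6 : wNorm w p e + ρ * ((1 - ρ)⁻¹ * wNorm w p e) = (1 - ρ)⁻¹ * wNorm w p e := by
        have : 1 - ρ ≠ 0 := by linarith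
        field_simp
        ring
      linarith
  refine WMem.of_forall_sum_le T.nonneg hp hK fun s => ?_
  obtain ⟨n, hn⟩ : ∃ n, ∀ x ∈ s, G.dist o x ≤ n :=
    ⟨s.sup (G.dist o), fun x hx => Finset.le_sup (f := G.dist o) hx⟩
  have h1 : ∑ x ∈ s, ‖u x‖ ^ p * w x = ∑ x ∈ s, ‖t n x‖ ^ p * w x :=
    Finset.sum_congr rfl fun x hx => by simp only [t]; rw [if_pos (hn x hx)]
  rw [h1]
  refine ((ht n).1.sum_le_tsum s fun x _ => wterm_nonneg T.nonneg _ x).trans ?_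
  rw [← wNorm_rpow T.nonneg hp]
  exact Real.rpow_le_rpow (wNorm_nonneg T.nonneg) (ht n).2 (by linarith)

/-- The function `u = 1 - δ_o` solves `u = e + shift u`, where `e` is the indicator of the finite
set of children of the root. -/
theorem wMem_one (T : TreeWeight G o q a w) (hp : 1 ≤ p) : WMem w p (1 : X → ℂ) := by
  classical
  have hd : WMem w p (Pi.single o 1 : X → ℂ) :=
    WMem.of_finite hp {o} fun x hx => Pi.single_eq_of_ne (by simpa using hx) _
  have he : WMem w p (fun x => if x ∈ G.children o o then (1 : ℂ) else 0) :=
    WMem.of_finite hp (G.children o o) fun x hx => if_neg hx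
  have h := (T.wMem_of_eq_add_shift hp (u := 1 - Pi.single o 1) (c := 1) (by simp) he (by simp) (by
    ext x
    by_cases hx : x = o
    · subst hx
      simp [SimpleGraph.shift_root, T.tree.mem_children]
    · by_cases hy : G.parent o x = o
      · simp [SimpleGraph.shift_apply _ hx, hx, T.tree.mem_children, hy]
      · simp [SimpleGraph.shift_apply _ hx, hx, T.tree.mem_children, hy])).1
  have h2 := (h.add T.nonneg hp hd).1
  rwa [sub_add_cancel] at h2

end TreeWeight

/-- The hypothesis `α > 1` is used for `q * q ^ (-α) < 1`, the condition that makes the shift a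
contraction. -/
theorem treeWeight_expWeight {X : Type*} {G : SimpleGraph X} [G.LocallyFinite] (hG : G.IsTree)
    {q : ℕ} (hq : 2 ≤ q) (hreg : G.IsRegularOfDegree (q + 1)) (o : X) {α : ℝ} (hα : 1 < α) :
    TreeWeight G o q ((q : ℝ) ^ (-α)) (expWeight G o q α) where
  tree := hG
  reg := hreg
  one_lt := hq
  root := by simp [expWeight]
  pos := expWeight_pos G o hq α
  step x hx := by
    have hq0 : (0 : ℝ) < q := by exact_mod_cast (by omega : 0 < q)
    rw [expWeight, expWeight, ← Real.rpow_add hq0, ← hG.dist_parent hx]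
    push_cast
    ring_nf
  ratio_pos := Real.rpow_pos_of_pos (by exact_mod_cast (by omega : 0 < q)) _
  mul_lt_one := by
    have hq1 : (1 : ℝ) < q := by exact_mod_cast hq
    have h := Real.rpow_lt_one_of_one_lt_of_neg hq1 (by linarith : 1 + -α < 0)
    rwa [Real.rpow_add (by linarith), Real.rpow_one] at h

/-! ### Innovations, their inversion, and the sibling projection. -/

namespace SimpleGraph

variable {X : Type*} {G : SimpleGraph X} {o : X}

/-- The solution `u` of `u = e + c • shift u`. -/
def solveShift (G : SimpleGraph X) (o : X) (c : ℂ) : (X → ℂ) →ₗ[ℂ] (X → ℂ) where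
  toFun e x := ∑ k ∈ Finset.range (G.dist o x), c ^ k * e ((G.parent o)^[k] x)
  map_add' e f := by
    ext x
    simp only [Pi.add_apply, mul_add, Finset.sum_add_distrib]
  map_smul' b e := by
    ext x
    simp only [Pi.smul_apply, smul_eq_mul, RingHom.id_apply, Finset.mul_sum]
    exact Finset.sum_congr rfl fun k _ => by ring

theorem solveShift_apply (c : ℂ) (e : X → ℂ) (x : X) : G.solveShift o c e x =
    ∑ k ∈ Finset.range (G.dist o x), c ^ k * e ((G.parent o)^[k] x) := rfl

theorem solveShift_root (c : ℂ) (e : X → ℂ) : G.solveShift o c e o = 0 := by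
  simp [solveShift_apply]

/-- The term `k = 0` is `e x`, and the others are `c` times the sum at the parent. The range stops
just before the ancestor `o`, hence the condition `e o = 0`. -/
theorem IsTree.solveShift_eq (hG : G.IsTree) (c : ℂ) {e : X → ℂ} (he : e o = 0) :
    G.solveShift o c e = e + c • G.shift o (G.solveShift o c e) := by
  ext x
  by_cases hx : x = o
  · simp [hx, he, shift_root, solveShift_root]
  · rw [Pi.add_apply, Pi.smul_apply, shift_apply _ hx, solveShift_apply, solveShift_apply,
      ← hG.dist_parent hx, Finset.sum_range_succ', smul_eq_mul, Finset.mul_sum, add_comm]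
    congr 1
    · simp
    · refine Finset.sum_congr rfl fun k _ => ?_
      rw [Function.iterate_succ_apply]
      ring

theorem IsTree.eq_solveShift (hG : G.IsTree) {c : ℂ} {u e : X → ℂ} (h0 : u o = 0)
    (hu : u = e + c • G.shift o u) : u = G.solveShift o c e := by
  have he : e o = 0 := by
    have h := congrFun hu o
    rw [Pi.add_apply, Pi.smul_apply, shift_root, smul_zero, add_zero] at h
    rw [← h, h0]
  suffices h : ∀ n x, G.dist o x = n → u x = G.solveShift o c e x from funext fun x => h _ x rfl
  intro n
  induction n with
  | zero =>
    intro x hx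
    rw [← hG.connected.dist_eq_zero_iff.1 hx, h0, solveShift_root]
  | succ n ih =>
    intro x hx
    have hxo : x ≠ o := by
      rintro rfl
      simp at hx
    have hd := hG.dist_parent hxo
    rw [hu, hG.solveShift_eq c he, Pi.add_apply, Pi.add_apply, Pi.smul_apply, Pi.smul_apply,
      shift_apply _ hxo, shift_apply _ hxo, ih _ (by omega)]

/-- For a function vanishing at the root, the edge differences `f (x) - f (parent x)`. -/
def edgeDiff (G : SimpleGraph X) (o : X) : (X → ℂ) →ₗ[ℂ] (X → ℂ) := LinearMap.id - G.shift o

/-- The innovations of `f`: the edge differences minus the value `q⁻¹ * edgeDiff f (parent x)`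
that is predicted from the preceding edge. -/
def innovation (G : SimpleGraph X) (o : X) (q : ℕ) : (X → ℂ) →ₗ[ℂ] (X → ℂ) :=
  (LinearMap.id - (q : ℂ)⁻¹ • G.shift o) ∘ₗ G.edgeDiff o

/-- The function vanishing at the root with prescribed innovations. -/
def ofInnovation (G : SimpleGraph X) (o : X) (q : ℕ) : (X → ℂ) →ₗ[ℂ] (X → ℂ) :=
  G.solveShift o 1 ∘ₗ G.solveShift o (q : ℂ)⁻¹

theorem eq_edgeDiff_add (f : X → ℂ) : f = G.edgeDiff o f + (1 : ℂ) • G.shift o f := by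
  simp [edgeDiff]

theorem edgeDiff_eq (q : ℕ) (f : X → ℂ) : G.edgeDiff o f =
    G.innovation o q f + (q : ℂ)⁻¹ • G.shift o (G.edgeDiff o f) := by
  simp [innovation]

theorem edgeDiff_root (f : X → ℂ) : G.edgeDiff o f o = f o := by
  simp [edgeDiff, shift_root]

theorem innovation_root (q : ℕ) (f : X → ℂ) : G.innovation o q f o = f o := by
  simp [innovation, shift_root, edgeDiff_root]

theorem ofInnovation_root (q : ℕ) (d : X → ℂ) : G.ofInnovation o q d o = 0 :=
  solveShift_root _ _

theorem IsTree.ofInnovation_innovation (hG : G.IsTree) (q : ℕ) {f : X → ℂ} (h0 : f o = 0) :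
    G.ofInnovation o q (G.innovation o q f) = f := by
  have h1 := hG.eq_solveShift (by rw [edgeDiff_root, h0]) (edgeDiff_eq (G := G) (o := o) q f)
  have h2 := hG.eq_solveShift h0 (eq_edgeDiff_add (G := G) (o := o) f)
  rw [ofInnovation, LinearMap.comp_apply, ← h1, ← h2]

theorem IsTree.innovation_ofInnovation (hG : G.IsTree) (q : ℕ) {d : X → ℂ} (h0 : d o = 0) :
    G.innovation o q (G.ofInnovation o q d) = d := by
  have h1 := hG.solveShift_eq (q : ℂ)⁻¹ h0
  have h2 := hG.solveShift_eq 1 (solveShift_root (G := G) (o := o) (q : ℂ)⁻¹ d)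
  have h3 : G.edgeDiff o (G.ofInnovation o q d) = G.solveShift o (q : ℂ)⁻¹ d := by
    rw [ofInnovation, LinearMap.comp_apply]
    conv_lhs => rw [edgeDiff, LinearMap.sub_apply, LinearMap.id_apply]
    rw [one_smul] at h2
    nth_rw 1 [h2]
    exact add_sub_cancel_right _ _
  rw [innovation, LinearMap.comp_apply, h3, LinearMap.sub_apply, LinearMap.id_apply,
    LinearMap.smul_apply]
  nth_rw 1 [h1]
  exact add_sub_cancel_right _ _

variable [G.LocallyFinite]

/-- The average over the children of a vertex. -/
def childAverage (G : SimpleGraph X) [G.LocallyFinite] (o : X) : (X → ℂ) →ₗ[ℂ] (X → ℂ) where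
  toFun h y := ((G.children o y).card : ℂ)⁻¹ * ∑ x ∈ G.children o y, h x
  map_add' e f := by
    ext x
    simp only [Pi.add_apply, Finset.sum_add_distrib, mul_add]
  map_smul' b e := by
    ext x
    simp only [Pi.smul_apply, smul_eq_mul, RingHom.id_apply, ← Finset.mul_sum]
    ring

/-- The projection that subtracts from a function its averages over siblings. -/
def siblingProj (G : SimpleGraph X) [G.LocallyFinite] (o : X) : (X → ℂ) →ₗ[ℂ] (X → ℂ) :=
  LinearMap.id - G.shift o ∘ₗ G.childAverage o

theorem siblingProj_eq (h : X → ℂ) :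
    G.siblingProj o h = h - G.shift o (G.childAverage o h) := rfl

theorem siblingProj_root (h : X → ℂ) : G.siblingProj o h o = h o := by
  simp [siblingProj_eq, shift_root]

theorem siblingProj_of_sum_eq_zero {h : X → ℂ} (hc : ∀ y, ∑ x ∈ G.children o y, h x = 0) :
    G.siblingProj o h = h := by
  have : G.childAverage o h = 0 := funext fun y => by simp [childAverage, hc]
  rw [siblingProj_eq, this, map_zero, sub_zero]

end SimpleGraph

/-! ### Harmonicity in terms of innovations, and norm bounds. -/

namespace TreeWeight

variable {X : Type*} {G : SimpleGraph X} [G.LocallyFinite] {o : X} {q : ℕ} {a : ℝ} {w : X → ℝ}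
  {p p' : ℝ}

theorem card_children_ne_zero (T : TreeWeight G o q a w) (y : X) :
    ((G.children o y).card : ℂ) ≠ 0 := by
  have := T.one_lt
  by_cases hy : y = o
  · rw [hy, SimpleGraph.card_children_root T.reg]
    exact_mod_cast Nat.succ_ne_zero q
  · rw [T.tree.card_children T.reg hy]
    exact_mod_cast (by omega : q ≠ 0)

theorem sum_children_siblingProj (T : TreeWeight G o q a w) (h : X → ℂ) (y : X) :
    ∑ x ∈ G.children o y, G.siblingProj o h x = 0 := by
  have h1 : ∀ x ∈ G.children o y, G.siblingProj o h x = h x - G.childAverage o h y :=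
    fun x hx => by
      rw [SimpleGraph.siblingProj_eq, Pi.sub_apply, T.shift_children hx]
  rw [Finset.sum_congr rfl h1, Finset.sum_sub_distrib, Finset.sum_const, nsmul_eq_mul]
  change _ - _ * (_ * _) = (0 : ℂ)
  rw [mul_inv_cancel_left₀ (T.card_children_ne_zero y), sub_self]

/-- Away from the root, the `q` predicted terms `q⁻¹ * (f y - f (parent y))` add up to one full edge
difference, which supplies the parent's share of the Laplacian. At the root the prediction vanishes
because `f o = 0`. -/
theorem sum_children_innovation (T : TreeWeight G o q a w) {f : X → ℂ} (h0 : f o = 0) (y : X) :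
    ∑ x ∈ G.children o y, G.innovation o q f x =
      -((q : ℂ) + 1) * combinatorialLaplacian G q f y := by
  have hq : (q : ℂ) ≠ 0 := by exact_mod_cast (zero_lt_one.trans T.one_lt).ne'
  have hq1 : (q : ℂ) + 1 ≠ 0 := by exact_mod_cast Nat.succ_ne_zero q
  have h1 : ∀ x ∈ G.children o y, G.innovation o q f x =
      f x - f y - (q : ℂ)⁻¹ * G.edgeDiff o f y := fun x hx => by
    rw [SimpleGraph.innovation, LinearMap.comp_apply, LinearMap.sub_apply, LinearMap.id_apply,
      LinearMap.smul_apply, Pi.sub_apply, Pi.smul_apply, T.shift_children hx, smul_eq_mul]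
    simp only [SimpleGraph.edgeDiff, LinearMap.sub_apply, LinearMap.id_apply, Pi.sub_apply,
      T.shift_children hx]
  rw [Finset.sum_congr rfl h1, Finset.sum_sub_distrib, Finset.sum_sub_distrib, Finset.sum_const,
    Finset.sum_const, nsmul_eq_mul, nsmul_eq_mul, combinatorialLaplacian]
  by_cases hy : y = o
  · rw [hy, SimpleGraph.edgeDiff_root, h0, SimpleGraph.neighborFinset_root]
    field_simp
    ring
  · rw [T.tree.card_children T.reg hy, T.tree.neighborFinset_eq_cons hy, Finset.sum_cons]
    simp only [SimpleGraph.edgeDiff, LinearMap.sub_apply, LinearMap.id_apply, Pi.sub_apply,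
      SimpleGraph.shift_apply _ hy]
    field_simp
    ring

theorem isHarmonicFun_iff (T : TreeWeight G o q a w) {f : X → ℂ} (h0 : f o = 0) :
    IsHarmonicFun G q f ↔ ∀ y, ∑ x ∈ G.children o y, G.innovation o q f x = 0 := by
  have hq1 : -((q : ℂ) + 1) ≠ 0 := neg_ne_zero.2 (by exact_mod_cast Nat.succ_ne_zero q)
  simp only [T.sum_children_innovation h0, mul_eq_zero, hq1, false_or]
  rfl

/-- Jensen's inequality on each set of siblings; `a⁻¹` comes from comparing the weight of a vertex
with that of its children. -/
theorem wMem_childAverage (T : TreeWeight G o q a w) (hp : 1 ≤ p) {h : X → ℂ}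
    (hh : WMem w p h) (h0 : h o = 0) : WMem w p (G.childAverage o h) ∧
      wNorm w p (G.childAverage o h) ≤ a⁻¹ ^ (1 / p) * wNorm w p h := by
  have hp0 : p ≠ 0 := by linarith
  have ha := T.ratio_pos
  have hs := T.tree.hasSum_children (o := o) (H := fun x => ‖h x‖ ^ p * w x)
    (by simp [h0, Real.zero_rpow hp0]) (Summable.hasSum hh)
  have hle : ∀ y, ‖G.childAverage o h y‖ ^ p * w y ≤
      a⁻¹ * ∑ x ∈ G.children o y, ‖h x‖ ^ p * w x := fun y => by
    have hn := T.card_children_ne_zero y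
    have hn1 : ((G.children o y).card : ℝ) ≠ 0 := by exact_mod_cast hn
    have h1 : ‖G.childAverage o h y‖ ≤
        ∑ x ∈ G.children o y, ((G.children o y).card : ℝ)⁻¹ * ‖h x‖ := by
      rw [← Finset.mul_sum]
      change ‖((G.children o y).card : ℂ)⁻¹ * _‖ ≤ _
      rw [norm_mul, norm_inv, Complex.norm_natCast]
      exact mul_le_mul_of_nonneg_left (norm_sum_le _ _) (by positivity)
    have h2 := Real.rpow_arith_mean_le_arith_mean_rpow (G.children o y)
      (fun _ => ((G.children o y).card : ℝ)⁻¹) (fun x => ‖h x‖) (fun _ _ => by positivity)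
      (by rw [Finset.sum_const, nsmul_eq_mul, mul_inv_cancel₀ hn1])
      (fun _ _ => norm_nonneg _) hp
    have h3 : ((G.children o y).card : ℝ)⁻¹ ≤ 1 := Nat.cast_inv_le_one _
    have h4 : ‖G.childAverage o h y‖ ^ p ≤ ∑ x ∈ G.children o y, ‖h x‖ ^ p :=
      (Real.rpow_le_rpow (norm_nonneg _) h1 (by linarith)).trans (h2.trans
        (Finset.sum_le_sum fun x _ => mul_le_of_le_one_left (by positivity) h3))
    have h5 : a⁻¹ * ∑ x ∈ G.children o y, ‖h x‖ ^ p * w x =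
        (∑ x ∈ G.children o y, ‖h x‖ ^ p) * w y := by
      rw [Finset.mul_sum, Finset.sum_mul]
      refine Finset.sum_congr rfl fun x hx => ?_
      rw [T.step_children hx]
      field_simp
    rw [h5]
    exact mul_le_mul_of_nonneg_right h4 (T.nonneg y)
  have hsM := hs.summable.mul_left a⁻¹
  have hm : WMem w p (G.childAverage o h) :=
    Summable.of_nonneg_of_le (wterm_nonneg T.nonneg _) hle hsM
  refine ⟨hm, wNorm_le_of_tsum_le T.nonneg hp
    (mul_nonneg (by positivity) (wNorm_nonneg T.nonneg)) ?_⟩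
  rw [Real.mul_rpow (by positivity) (wNorm_nonneg T.nonneg), ← Real.rpow_mul (by positivity),
    one_div_mul_cancel hp0, Real.rpow_one, wNorm_rpow T.nonneg hp, ← hs.tsum_eq, ← tsum_mul_left]
  exact Summable.tsum_le_tsum hle hm hsM

theorem wMem_siblingProj (T : TreeWeight G o q a w) (hp : 1 ≤ p) : ∃ C, 0 ≤ C ∧ ∀ h : X → ℂ,
    WMem w p h → h o = 0 → WMem w p (G.siblingProj o h) ∧
      wNorm w p (G.siblingProj o h) ≤ C * wNorm w p h := by
  have ha := T.ratio_pos
  refine ⟨1 + ((q + 1) * a) ^ (1 / p) * a⁻¹ ^ (1 / p), by positivity, fun h hh h0 => ?_⟩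
  have h1 := T.wMem_childAverage hp hh h0
  have h2 := T.wMem_shift hp h1.1
  have h3 := hh.sub T.nonneg hp h2.1
  refine ⟨h3.1, h3.2.trans ?_⟩
  have h4 := h2.2.trans (mul_le_mul_of_nonneg_left h1.2 (by positivity))
  linarith

theorem wMem_ofInnovation (T : TreeWeight G o q a w) (hp : 1 ≤ p) : ∃ C, 0 ≤ C ∧ ∀ d : X → ℂ,
    WMem w p d → d o = 0 → WMem w p (G.ofInnovation o q d) ∧
      wNorm w p (G.ofInnovation o q d) ≤ C * wNorm w p d := by
  have hK : 0 ≤ (1 - ((q : ℝ) * a) ^ (1 / p))⁻¹ :=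
    inv_nonneg.2 (sub_nonneg.2 (T.factor_lt_one hp).le)
  have hq : ‖((q : ℂ))⁻¹‖ ≤ 1 := by
    rw [norm_inv, Complex.norm_natCast]
    exact Nat.cast_inv_le_one q
  refine ⟨_, mul_nonneg hK hK, fun d hd h0 => ?_⟩
  have h1 := T.wMem_of_eq_add_shift hp hq hd (SimpleGraph.solveShift_root _ _)
    (T.tree.solveShift_eq _ h0)
  have h2 := T.wMem_of_eq_add_shift (c := 1) hp (by simp) h1.1 (SimpleGraph.solveShift_root _ _)
    (T.tree.solveShift_eq _ (SimpleGraph.solveShift_root _ _))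
  refine ⟨h2.1, h2.2.trans ?_⟩
  rw [mul_assoc]
  exact mul_le_mul_of_nonneg_left h1.2 hK

theorem wMem_edgeDiff (T : TreeWeight G o q a w) (hp : 1 ≤ p) {f : X → ℂ} (hf : WMem w p f) :
    WMem w p (G.edgeDiff o f) :=
  (hf.sub T.nonneg hp (T.wMem_shift hp hf).1).1

theorem wMem_innovation (T : TreeWeight G o q a w) (hp : 1 ≤ p) {f : X → ℂ} (hf : WMem w p f) :
    WMem w p (G.innovation o q f) :=
  ((T.wMem_edgeDiff hp hf).sub T.nonneg hp
    ((T.wMem_shift hp (T.wMem_edgeDiff hp hf)).1.smul T.nonneg hp _).1).1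

end TreeWeight

section WeightedLp

variable {X : Type*} {w : X → ℝ} {p p' : ℝ} {f g : X → ℂ}

theorem WMem.pair_add_right (hw : ∀ x, 0 ≤ w x) (hpp : p.HolderConjugate p') {g₁ g₂ : X → ℂ}
    (hf : WMem w p f) (hg : WMem w p' g₁) (hg' : WMem w p' g₂) :
    wPair w f (g₁ + g₂) = wPair w f g₁ + wPair w f g₂ := by
  rw [wPair_comm, hg.pair_add hw hpp.symm hg' hf, wPair_comm g₁, wPair_comm g₂]

theorem wPair_smul_right (c : ℂ) (f g : X → ℂ) : wPair w f (c • g) = c * wPair w f g := by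
  rw [wPair_comm, wPair_smul, wPair_comm]

end WeightedLp

/-! ### The pairing in terms of innovations. -/

namespace TreeWeight

variable {X : Type*} {G : SimpleGraph X} [G.LocallyFinite] {o : X} {q : ℕ} {a : ℝ} {w : X → ℝ}
  {p p' : ℝ}

/-- The pairing of a harmonic function vanishing at the root with a shifted function, in terms of
its edge differences. -/
theorem wPair_edgeDiff_shift (T : TreeWeight G o q a w) (hpp : p.HolderConjugate p')
    {f g : X → ℂ} (hf : WMem w p f) (hg : WMem w p' g) (hf0 : f o = 0)
    (hc : ∀ y, ∑ x ∈ G.children o y, G.innovation o q f x = 0) :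
    wPair w (G.edgeDiff o f) (G.shift o g) = a * wPair w (G.edgeDiff o f) g := by
  have hp := hpp.lt.le
  have hp' := hpp.symm.lt.le
  have h1 := T.wMem_edgeDiff hp hf
  have hq : (q : ℂ) ≠ 0 := by exact_mod_cast (zero_lt_one.trans T.one_lt).ne'
  -- The innovation part is orthogonal to shifts, and the rest gives `q⁻¹ * (q * a) = a`.
  conv_lhs => rw [SimpleGraph.edgeDiff_eq q f]
  rw [(T.wMem_innovation hp hf).pair_add T.nonneg hpp
      ((T.wMem_shift hp h1).1.smul T.nonneg hp _).1 (T.wMem_shift hp' hg).1,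
    T.wPair_shift_eq_zero hpp (T.wMem_innovation hp hf) hg
      (by rw [SimpleGraph.innovation_root, hf0]) hc, wPair_smul,
    T.wPair_shift_shift hpp h1 hg (by rw [SimpleGraph.edgeDiff_root, hf0]), zero_add,
    ← mul_assoc, ← mul_assoc, inv_mul_cancel₀ hq, one_mul]

/-- The factor between the pairing of two functions and that of their innovations. -/
def pairFactor (q : ℕ) (a : ℝ) : ℂ := (1 + a) / ((1 - q * a) * (1 - a) * (1 - a / q))

theorem ratio_lt_one (T : TreeWeight G o q a w) : a < 1 := by
  have h1 : (1 : ℝ) ≤ q := by exact_mod_cast T.one_lt.le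
  nlinarith [T.mul_lt_one, T.ratio_pos]

theorem pairFactor_denom (T : TreeWeight G o q a w) :
    (1 - q * a : ℂ) ≠ 0 ∧ (1 - a : ℂ) ≠ 0 ∧ (1 - a / q : ℂ) ≠ 0 ∧ (1 + a : ℂ) ≠ 0 := by
  have h1 := T.mul_lt_one
  have h2 := T.ratio_lt_one
  have h3 := T.ratio_pos
  have h4 : a / q < 1 := by
    rw [div_lt_one T.q_pos]
    exact h2.trans (by exact_mod_cast T.one_lt)
  refine ⟨?_, ?_, ?_, ?_⟩
  · exact_mod_cast (by linarith : 1 - q * a ≠ 0)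
  · exact_mod_cast (by linarith : 1 - a ≠ 0)
  · exact_mod_cast (by linarith : 1 - a / q ≠ 0)
  · exact_mod_cast (by linarith : 1 + a ≠ 0)

theorem pairFactor_ne_zero (T : TreeWeight G o q a w) : pairFactor q a ≠ 0 := by
  obtain ⟨h1, h2, h3, h4⟩ := T.pairFactor_denom
  exact div_ne_zero h4 (mul_ne_zero (mul_ne_zero h1 h2) h3)

/-- With `D = 1 - S`, `P = ⟨f, g⟩`, `E = ⟨D f, D g⟩`, `A = ⟨D f, S g⟩`, `B = ⟨S f, D g⟩` and `N` the
pairing of innovations, expanding gives the linear system `E = N + (a / q) E`, `A = a (E + A)`, `B =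
a (E + B)`, `P = E + A + B + q a P`. Solving it yields `P = κ N`. -/
theorem wPair_eq_innovation (T : TreeWeight G o q a w) (hpp : p.HolderConjugate p')
    {f g : X → ℂ} (hf : WMem w p f) (hg : WMem w p' g) (hf0 : f o = 0) (hg0 : g o = 0)
    (hfc : ∀ y, ∑ x ∈ G.children o y, G.innovation o q f x = 0)
    (hgc : ∀ y, ∑ x ∈ G.children o y, G.innovation o q g x = 0) :
    wPair w f g = pairFactor q a * wPair w (G.innovation o q f) (G.innovation o q g) := by
  have hp := hpp.lt.le
  have hp' := hpp.symm.lt.le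
  have hq : (q : ℂ) ≠ 0 := by exact_mod_cast (zero_lt_one.trans T.one_lt).ne'
  have hSf := (T.wMem_shift hp hf).1
  have hSg := (T.wMem_shift hp' hg).1
  have hf1 := T.wMem_edgeDiff hp hf
  have hg1 := T.wMem_edgeDiff hp' hg
  have hSf1 := (T.wMem_shift hp hf1).1
  have hSg1 := (T.wMem_shift hp' hg1).1
  have hdf := T.wMem_innovation hp hf
  have hdg := T.wMem_innovation hp' hg
  have hdf0 : G.innovation o q f o = 0 := by rw [SimpleGraph.innovation_root, hf0]
  have hdg0 : G.innovation o q g o = 0 := by rw [SimpleGraph.innovation_root, hg0]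
  have hf10 : G.edgeDiff o f o = 0 := by rw [SimpleGraph.edgeDiff_root, hf0]
  have e1 : wPair w (G.edgeDiff o f) (G.edgeDiff o g) =
      wPair w (G.innovation o q f) (G.innovation o q g) +
        a / q * wPair w (G.edgeDiff o f) (G.edgeDiff o g) := by
    conv_lhs => rw [SimpleGraph.edgeDiff_eq q f, SimpleGraph.edgeDiff_eq q g]
    rw [hdf.pair_add T.nonneg hpp (hSf1.smul T.nonneg hp _).1
        (hdg.add T.nonneg hp' (hSg1.smul T.nonneg hp' _).1).1,
      hdf.pair_add_right T.nonneg hpp hdg (hSg1.smul T.nonneg hp' _).1,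
      (hSf1.smul T.nonneg hp _).1.pair_add_right T.nonneg hpp hdg (hSg1.smul T.nonneg hp' _).1,
      wPair_smul_right, T.wPair_shift_eq_zero hpp hdf hg1 hdf0 hfc, wPair_smul, wPair_smul,
      wPair_smul_right, wPair_comm (G.shift o _) (G.innovation o q g),
      T.wPair_shift_eq_zero hpp.symm hdg hf1 hdg0 hgc, T.wPair_shift_shift hpp hf1 hg1 hf10]
    field_simp
    ring
  have e2 : wPair w (G.edgeDiff o f) (G.shift o g) =
      a * (wPair w (G.edgeDiff o f) (G.edgeDiff o g) + wPair w (G.edgeDiff o f) (G.shift o g)) := by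
    rw [← hf1.pair_add_right T.nonneg hpp hg1 hSg, T.wPair_edgeDiff_shift hpp hf hg hf0 hfc]
    conv_lhs => rw [SimpleGraph.eq_edgeDiff_add (G := G) (o := o) g, one_smul]
  have e3 : wPair w (G.shift o f) (G.edgeDiff o g) =
      a * (wPair w (G.edgeDiff o f) (G.edgeDiff o g) + wPair w (G.shift o f) (G.edgeDiff o g)) := by
    rw [← hf1.pair_add T.nonneg hpp hSf hg1, wPair_comm (G.shift o f),
      T.wPair_edgeDiff_shift hpp.symm hg hf hg0 hgc, wPair_comm (G.edgeDiff o g)]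
    conv_lhs => rw [SimpleGraph.eq_edgeDiff_add (G := G) (o := o) f, one_smul]
  have e4 : wPair w f g = wPair w (G.edgeDiff o f) (G.edgeDiff o g) +
      wPair w (G.edgeDiff o f) (G.shift o g) + (wPair w (G.shift o f) (G.edgeDiff o g) +
        q * a * wPair w f g) := by
    conv_lhs => rw [SimpleGraph.eq_edgeDiff_add (G := G) (o := o) f,
      SimpleGraph.eq_edgeDiff_add (G := G) (o := o) g, one_smul, one_smul]
    rw [hf1.pair_add T.nonneg hpp hSf (hg1.add T.nonneg hp' hSg).1,
      hf1.pair_add_right T.nonneg hpp hg1 hSg, hSf.pair_add_right T.nonneg hpp hg1 hSg,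
      T.wPair_shift_shift hpp hf hg hf0]
  obtain ⟨h1, h2, h3, h4⟩ := T.pairFactor_denom
  rw [pairFactor, div_mul_eq_mul_div, eq_div_iff (mul_ne_zero (mul_ne_zero h1 h2) h3)]
  linear_combination (1 - a : ℂ) * (1 - a / q) * e4 + (1 - a / q : ℂ) * e2 +
    (1 - a / q : ℂ) * e3 + (1 + a : ℂ) * e1

/-- Since `S 1` equals 1 off the root, `⟨D f, 1⟩ = a ⟨D f, 1⟩` with `D = 1 - S`, so this pairing
vanishes. Then `⟨f, 1⟩ = q a ⟨f, 1⟩` vanishes as well. -/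
theorem wPair_one_eq_zero (T : TreeWeight G o q a w) (hpp : p.HolderConjugate p')
    {f : X → ℂ} (hf : WMem w p f) (hf0 : f o = 0)
    (hfc : ∀ y, ∑ x ∈ G.children o y, G.innovation o q f x = 0) : wPair w f 1 = 0 := by
  have hp := hpp.lt.le
  have hp' := hpp.symm.lt.le
  have h1 := T.wMem_one hp'
  have hS : ∀ u : X → ℂ, u o = 0 → wPair w u (G.shift o 1) = wPair w u 1 := fun u hu =>
    tsum_congr fun x => by
      by_cases hx : x = o
      · simp [hx, hu]
      · rw [SimpleGraph.shift_apply _ hx]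
        rfl
  have hf1 := T.wMem_edgeDiff hp hf
  have e1 := T.wPair_edgeDiff_shift hpp hf h1 hf0 hfc
  rw [hS _ (by rw [SimpleGraph.edgeDiff_root, hf0])] at e1
  have e2 : wPair w f 1 = wPair w (G.edgeDiff o f) 1 + q * a * wPair w f 1 := by
    conv_lhs => rw [SimpleGraph.eq_edgeDiff_add (G := G) (o := o) f, one_smul]
    rw [hf1.pair_add T.nonneg hpp (T.wMem_shift hp hf).1 h1,
      ← hS _ (SimpleGraph.shift_root f), T.wPair_shift_shift hpp hf h1 hf0]
  obtain ⟨h1, h2, -, -⟩ := T.pairFactor_denom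
  have e3 : wPair w (G.edgeDiff o f) 1 = 0 := by
    refine (mul_eq_zero.1 (?_ : (1 - a : ℂ) * _ = 0)).resolve_left h2
    linear_combination e1
  refine (mul_eq_zero.1 (?_ : (1 - q * a : ℂ) * _ = 0)).resolve_left h1
  linear_combination e2 + e3

/-- The pairing of two functions in terms of their values at the root and their innovations. -/
theorem wPair_add_const (T : TreeWeight G o q a w) (hpp : p.HolderConjugate p')
    {f g : X → ℂ} (hf : WMem w p f) (hg : WMem w p' g) (hf0 : f o = 0) (hg0 : g o = 0)
    (hfc : ∀ y, ∑ x ∈ G.children o y, G.innovation o q f x = 0)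
    (hgc : ∀ y, ∑ x ∈ G.children o y, G.innovation o q g x = 0) (b c : ℂ) :
    wPair w (b • 1 + f) (c • 1 + g) = b * c * wPair w (1 : X → ℂ) 1 +
      pairFactor q a * wPair w (G.innovation o q f) (G.innovation o q g) := by
  have hp := hpp.lt.le
  have hp' := hpp.symm.lt.le
  have h1 := ((T.wMem_one hp).smul T.nonneg hp b).1
  have h2 := ((T.wMem_one hp').smul T.nonneg hp' c).1
  rw [h1.pair_add T.nonneg hpp hf (h2.add T.nonneg hp' hg).1,
    h1.pair_add_right T.nonneg hpp h2 hg, hf.pair_add_right T.nonneg hpp h2 hg, wPair_smul,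
    wPair_smul_right, wPair_smul, wPair_smul_right, wPair_comm 1 g,
    T.wPair_one_eq_zero hpp hf hf0 hfc, T.wPair_one_eq_zero hpp.symm hg hg0 hgc,
    T.wPair_eq_innovation hpp hf hg hf0 hg0 hfc hgc]
  ring

theorem wPair_one_one_ne_zero (T : TreeWeight G o q a w) : wPair w (1 : X → ℂ) 1 ≠ 0 := by
  have h1 := T.wMem_one le_rfl
  have h2 : wPair w (1 : X → ℂ) 1 = ((∑' x, w x : ℝ) : ℂ) := by
    rw [wPair, Complex.ofReal_tsum]
    simp
  have h3 : Summable w := by simpa [WMem] using h1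
  rw [h2, Complex.ofReal_ne_zero]
  exact (h3.tsum_pos T.nonneg o (T.pos o)).ne'

end TreeWeight

/-! ### The dual of weighted `ℓ^p`. -/

section WeightedLp

variable {X : Type*} {w : X → ℝ} {p p' : ℝ}

/-- The weighted `ℓ^p` space as a space of functions. -/
def wSubmodule (hw : ∀ x, 0 ≤ w x) (hp : 1 ≤ p) : Submodule ℂ (X → ℂ) where
  carrier := {f | WMem w p f}
  zero_mem' := WMem.of_finite hp ∅ fun _ _ => rfl
  add_mem' hf hg := (WMem.add hw hp hf hg).1
  smul_mem' c _ hf := (WMem.smul hw hp c hf).1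

variable {hw : ∀ x, 0 ≤ w x} {hp : 1 ≤ p}

open scoped Classical in
/-- The restriction of a function to a finite set, extended by zero. -/
def wTrunc (hw : ∀ x, 0 ≤ w x) (hp : 1 ≤ p) (s : Finset X) (f : X → ℂ) : wSubmodule hw hp :=
  ⟨fun x => if x ∈ s then f x else 0, WMem.of_finite hp s fun _ hx => if_neg hx⟩

theorem map_wTrunc (ψ : wSubmodule hw hp →ₗ[ℂ] ℂ) (s : Finset X) (f : X → ℂ) :
    ψ (wTrunc hw hp s f) = ∑ x ∈ s, f x * ψ (wTrunc hw hp {x} 1) := by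
  classical
  have h : wTrunc hw hp s f = ∑ x ∈ s, f x • wTrunc hw hp {x} 1 := by
    refine Subtype.ext (funext fun y => ?_)
    rw [Submodule.coe_sum, Finset.sum_apply]
    simp [wTrunc]
  rw [h, map_sum]
  simp only [map_smul, smul_eq_mul]

theorem wNorm_wTrunc (s : Finset X) (f : X → ℂ) :
    wNorm w p (wTrunc hw hp s f).1 = (∑ x ∈ s, ‖f x‖ ^ p * w x) ^ (1 / p) := by
  have hp0 : p ≠ 0 := by linarith
  rw [wNorm, tsum_eq_sum (s := s)]
  · congr 1
    exact Finset.sum_congr rfl fun x hx => by simp [wTrunc, hx]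
  · intro x hx
    simp [wTrunc, hx, Real.zero_rpow hp0]

theorem tendsto_wNorm_sub_wTrunc (f : X → ℂ) :
    Filter.Tendsto (fun s : Finset X => wNorm w p (f - (wTrunc hw hp s f).1)) Filter.atTop
      (nhds 0) := by
  have hp0 : p ≠ 0 := by linarith
  have h1 := (tendsto_tsum_compl_atTop_zero fun x => ‖f x‖ ^ p * w x).rpow_const
    (p := 1 / p) (Or.inr (by positivity))
  rw [Real.zero_rpow (by positivity)] at h1
  refine h1.congr fun s => ?_
  rw [wNorm]
  congr 1
  refine (tsum_subtype {x | x ∉ s} fun x => ‖f x‖ ^ p * w x).trans (tsum_congr fun x => ?_)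
  by_cases hx : x ∈ s <;> simp [wTrunc, hx, Real.zero_rpow hp0]

/-- Divide by `S ^ (1 / p)`. This extracts the `ℓ^p'` bound from testing a functional on the
extremal function for Hölder's inequality. -/
theorem rpow_sum_le_of_le_mul_rpow {S C : ℝ} (hpp : p.HolderConjugate p') (hS : 0 ≤ S)
    (hC : 0 ≤ C) (h : S ≤ C * S ^ (1 / p)) : S ≤ C ^ p' := by
  rcases hS.eq_or_lt with rfl | hS
  · exact Real.rpow_nonneg hC _
  · have h1 : S = S ^ (1 / p') * S ^ (1 / p) := by
      rw [← Real.rpow_add hS, one_div, one_div, add_comm, hpp.inv_add_inv_eq_one, Real.rpow_one]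
    have h2 : S ^ (1 / p') ≤ C := by
      refine le_of_mul_le_mul_right ?_ (Real.rpow_pos_of_pos hS (1 / p))
      rwa [← h1]
    have h3 := Real.rpow_le_rpow (Real.rpow_nonneg hS.le _) h2 hpp.symm.pos.le
    rwa [← Real.rpow_mul hS.le, one_div_mul_cancel hpp.symm.ne_zero, Real.rpow_one] at h3

/-- Bounded functionals on weighted `ℓ^p` are pairings with functions in weighted `ℓ^p'`. -/
theorem exists_eq_wPair (hw0 : ∀ x, 0 < w x) (hpp : p.HolderConjugate p')
    (ψ : wSubmodule hw hp →ₗ[ℂ] ℂ) {C : ℝ} (hC : 0 ≤ C) (hψ : ∀ f, ‖ψ f‖ ≤ C * wNorm w p f.1) :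
    ∃ h : X → ℂ, (∀ x, h x = ψ (wTrunc hw hp {x} 1) / w x) ∧ WMem w p' h ∧ wNorm w p' h ≤ C ∧
      ∀ f, ψ f = wPair w f.1 h := by
  set h : X → ℂ := fun x => ψ (wTrunc hw hp {x} 1) / w x
  have hx : ∀ x, ψ (wTrunc hw hp {x} 1) = h x * w x := fun x =>
    (div_mul_cancel₀ _ (by exact_mod_cast (hw0 x).ne')).symm
  have hT : ∀ s f, ψ (wTrunc hw hp s f) = ∑ x ∈ s, f x * h x * w x := fun s f => by
    rw [map_wTrunc]
    exact Finset.sum_congr rfl fun x _ => by rw [hx, mul_assoc]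
  have hh := WMem.of_forall_sum_le (f := h) hw hpp.symm.lt.le hC fun s => by
    -- The extremal function for Hölder. Where `h x = 0` the conjugate factor makes `t x = 0`,
    -- whatever the power of 0 is.
    let t : X → ℂ := fun x => (starRingEnd ℂ) (h x) * ((‖h x‖ ^ (p' - 2) : ℝ) : ℂ)
    have ht : ∀ x, t x * h x = ((‖h x‖ ^ p' : ℝ) : ℂ) := fun x => by
      by_cases h0 : h x = 0
      · simp [h0, Real.zero_rpow hpp.symm.ne_zero]
      · have h1 : 0 < ‖h x‖ := norm_pos_iff.2 h0
        have h2 : (starRingEnd ℂ) (h x) * h x = ((‖h x‖ ^ (2 : ℝ) : ℝ) : ℂ) := by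
          rw [mul_comm, Complex.mul_conj, Complex.normSq_eq_norm_sq]
          norm_num
        calc t x * h x = (starRingEnd ℂ) (h x) * h x * ((‖h x‖ ^ (p' - 2) : ℝ) : ℂ) := by
              simp only [t]
              ring
          _ = _ := by
              rw [h2, ← Complex.ofReal_mul, ← Real.rpow_add h1]
              ring_nf
    have ht' : ∀ x, ‖t x‖ ^ p = ‖h x‖ ^ p' := fun x => by
      by_cases h0 : h x = 0
      · simp [t, h0, Real.zero_rpow hpp.symm.ne_zero, Real.zero_rpow hpp.ne_zero]
      · have h1 : 0 < ‖h x‖ := norm_pos_iff.2 h0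
        have h2 : ‖t x‖ = ‖h x‖ ^ (p' - 1) := by
          simp only [t]
          rw [norm_mul, RCLike.norm_conj, Complex.norm_of_nonneg (by positivity)]
          nth_rw 1 [← Real.rpow_one ‖h x‖]
          rw [← Real.rpow_add h1]
          ring_nf
        rw [h2, ← Real.rpow_mul h1.le, hpp.symm.sub_one_mul_conj]
    have hS : 0 ≤ ∑ x ∈ s, ‖h x‖ ^ p' * w x := Finset.sum_nonneg fun x _ => wterm_nonneg hw h x
    refine rpow_sum_le_of_le_mul_rpow hpp hS hC ?_
    have h1 := hψ (wTrunc hw hp s t)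
    rw [wNorm_wTrunc, hT] at h1
    simp only [ht, ht'] at h1
    refine le_trans (le_of_eq ?_) h1
    rw [← Complex.norm_of_nonneg hS]
    push_cast
    rfl
  refine ⟨h, fun _ => rfl, hh.1, hh.2, fun f => ?_⟩
  have h1 := (WMem.hasSum_pair hw hpp f.2 hh.1).2.1
  -- Partial sums of the pairing are values of `ψ` at truncations of `f`, which tend to `f` in norm.
  refine tendsto_nhds_unique ?_ h1
  rw [tendsto_iff_norm_sub_tendsto_zero]
  refine squeeze_zero (fun _ => norm_nonneg _) (fun s => ?_)
    (by simpa using (tendsto_wNorm_sub_wTrunc (hw := hw) (hp := hp) f.1).const_mul C)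
  rw [norm_sub_rev, ← hT s f.1, ← map_sub]
  exact hψ _

end WeightedLp

/-! ### Duality of the Bergman spaces. -/

namespace TreeWeight

variable {X : Type*} {G : SimpleGraph X} [G.LocallyFinite] {o : X} {q : ℕ} {a : ℝ} {w : X → ℝ}
  {p p' : ℝ}

theorem isHarmonicFun_one (T : TreeWeight G o q a w) : IsHarmonicFun G q 1 := fun v => by
  have hq1 : (q : ℂ) + 1 ≠ 0 := by exact_mod_cast Nat.succ_ne_zero q
  simp only [combinatorialLaplacian, Pi.one_apply, Finset.sum_const, nsmul_eq_mul,
    G.card_neighborFinset_eq_degree, T.reg v]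
  push_cast
  field_simp
  ring

theorem isHarmonicFun_ofInnovation (T : TreeWeight G o q a w) {d : X → ℂ} (h0 : d o = 0)
    (hc : ∀ y, ∑ x ∈ G.children o y, d x = 0) : IsHarmonicFun G q (G.ofInnovation o q d) := by
  rw [T.isHarmonicFun_iff (SimpleGraph.ofInnovation_root q d),
    T.tree.innovation_ofInnovation q h0]
  exact hc

end TreeWeight

open scoped Classical in
/-- Replace the value at `o` by zero. -/
def eraseAt {X : Type*} (o : X) : (X → ℂ) →ₗ[ℂ] (X → ℂ) where
  toFun t x := if x = o then 0 else t x
  map_add' s t := by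
    ext x
    by_cases h : x = o <;> simp [h]
  map_smul' c t := by
    ext x
    by_cases h : x = o <;> simp [h]

theorem eraseAt_self {X : Type*} (o : X) (t : X → ℂ) : eraseAt o t o = 0 := if_pos rfl

theorem eraseAt_of_eq_zero {X : Type*} {o : X} {t : X → ℂ} (h : t o = 0) : eraseAt o t = t := by
  ext x
  by_cases hx : x = o
  · rw [hx, eraseAt_self, h]
  · exact if_neg hx

theorem norm_eraseAt_le {X : Type*} (o : X) (t : X → ℂ) (x : X) : ‖eraseAt o t x‖ ≤ ‖t x‖ := by
  by_cases hx : x = o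
  · rw [hx, eraseAt_self, norm_zero]
    exact norm_nonneg _
  · exact le_of_eq (congrArg _ (if_neg hx))

namespace BergmanSpace

variable {X : Type*} {G : SimpleGraph X} [G.LocallyFinite] {o : X} {q : ℕ} {hq : 2 ≤ q}
  {α a p p' : ℝ} {hp : 1 ≤ p} {hp' : 1 ≤ p'}

theorem wMem (f : BergmanSpace G o hq α hp) : WMem (expWeight G o q α) p f.1 := f.2.2

theorem norm_eq_wNorm (f : BergmanSpace G o hq α hp) :
    ‖f‖ = wNorm (expWeight G o q α) p f.1 := rfl

/-- The pairing `∑ z, f (z) * g (z) * q ^ (-α |z|)` as a bounded map into the dual space. -/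
def pairing (hpp : p.HolderConjugate p') :
    BergmanSpace G o hq α hp' →L[ℂ] StrongDual ℂ (BergmanSpace G o hq α hp) :=
  LinearMap.mkContinuous₂
    (LinearMap.mk₂ ℂ (fun g f => wPair (expWeight G o q α) f.1 g.1)
      (fun g g' f => f.wMem.pair_add_right (expWeight_nonneg G o q α) hpp g.wMem g'.wMem)
      (fun c g f => wPair_smul_right c f.1 g.1)
      (fun g f f' => f.wMem.pair_add (expWeight_nonneg G o q α) hpp f'.wMem g.wMem)
      (fun c g f => wPair_smul c f.1 g.1)) 1 fun g f => by
    rw [one_mul, mul_comm]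
    exact (f.wMem.hasSum_pair (expWeight_nonneg G o q α) hpp g.wMem).2.2

theorem pairing_apply (hpp : p.HolderConjugate p') (g : BergmanSpace G o hq α hp')
    (f : BergmanSpace G o hq α hp) :
    pairing hpp g f = wPair (expWeight G o q α) f.1 g.1 := rfl

theorem norm_pairing_le (hpp : p.HolderConjugate p') (g : BergmanSpace G o hq α hp') :
    ‖pairing (hp := hp) hpp g‖ ≤ ‖g‖ := by
  refine ContinuousLinearMap.opNorm_le_bound _ (norm_nonneg _) fun f => ?_
  rw [mul_comm]
  exact (f.wMem.hasSum_pair (expWeight_nonneg G o q α) hpp g.wMem).2.2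

/-- The constant function `1`. -/
def constOne (T : TreeWeight G o q a (expWeight G o q α)) : BergmanSpace G o hq α hp :=
  ⟨1, T.isHarmonicFun_one, T.wMem_one hp⟩

/-- The harmonic function vanishing at the root whose innovations are the projection of a given
function. -/
def synthesis (T : TreeWeight G o q a (expWeight G o q α)) :
    wSubmodule T.nonneg hp →ₗ[ℂ] BergmanSpace G o hq α hp :=
  LinearMap.codRestrict (bergmanSubmodule G o q α hp)
    ((G.ofInnovation o q ∘ₗ G.siblingProj o ∘ₗ eraseAt o) ∘ₗ (wSubmodule T.nonneg hp).subtype)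
    fun t => by
      obtain ⟨_, -, h1⟩ := T.wMem_siblingProj hp
      obtain ⟨_, -, h2⟩ := T.wMem_ofInnovation hp
      have h3 := (h1 _ (t.2.mono T.nonneg hp (norm_eraseAt_le o t.1)).1 (eraseAt_self o _)).1
      have h4 : G.siblingProj o (eraseAt o t.1) o = 0 := by
        rw [SimpleGraph.siblingProj_root, eraseAt_self]
      exact ⟨T.isHarmonicFun_ofInnovation h4 (T.sum_children_siblingProj _), (h2 _ h3 h4).1⟩

theorem synthesis_coe (T : TreeWeight G o q a (expWeight G o q α)) (t : wSubmodule T.nonneg hp) :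
    (synthesis (hq := hq) T t).1 = G.ofInnovation o q (G.siblingProj o (eraseAt o t.1)) := rfl

theorem exists_norm_synthesis_le (hq : 2 ≤ q) (hp : 1 ≤ p)
    (T : TreeWeight G o q a (expWeight G o q α)) :
    ∃ C, 0 ≤ C ∧ ∀ t, ‖synthesis (hq := hq) (hp := hp) T t‖ ≤
      C * wNorm (expWeight G o q α) p t.1 := by
  obtain ⟨C₁, hC₁, h1⟩ := T.wMem_siblingProj hp
  obtain ⟨C₂, hC₂, h2⟩ := T.wMem_ofInnovation hp
  refine ⟨C₂ * C₁, mul_nonneg hC₂ hC₁, fun t => ?_⟩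
  have h5 := t.2.mono T.nonneg hp (norm_eraseAt_le o t.1)
  have h3 := h1 _ h5.1 (eraseAt_self o _)
  have h4 := (h2 _ h3.1 (by rw [SimpleGraph.siblingProj_root, eraseAt_self])).2
  rw [norm_eq_wNorm, synthesis_coe, mul_assoc]
  exact h4.trans (mul_le_mul_of_nonneg_left
    (h3.2.trans (mul_le_mul_of_nonneg_left h5.2 hC₁)) hC₂)

/-- Every bounded functional is a pairing, with norm control. -/
theorem exists_pairing_eq (hq : 2 ≤ q) (hp : 1 ≤ p) (hp' : 1 ≤ p')
    (T : TreeWeight G o q a (expWeight G o q α)) (hpp : p.HolderConjugate p') :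
    ∃ K, 0 < K ∧ ∀ φ : StrongDual ℂ (BergmanSpace G o hq α hp),
      ∃ g : BergmanSpace G o hq α hp', pairing hpp g = φ ∧ ‖g‖ ≤ K * ‖φ‖ := by
  set w := expWeight G o q α
  obtain ⟨C, hC, hS⟩ := exists_norm_synthesis_le hq hp T
  obtain ⟨C', hC', hS'⟩ := exists_norm_synthesis_le hq hp' T
  set W := wPair w (1 : X → ℂ) 1
  have hW : W ≠ 0 := T.wPair_one_one_ne_zero
  have hκ : TreeWeight.pairFactor q a ≠ 0 := T.pairFactor_ne_zero
  set κ := TreeWeight.pairFactor q a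
  let e : BergmanSpace G o hq α hp := constOne T
  let e' : BergmanSpace G o hq α hp' := constOne T
  -- One term for each summand of the representing function; the `+ 1` only ensures positivity.
  refine ⟨‖e‖ / ‖W‖ * ‖e'‖ + ‖κ⁻¹‖ * (C' * C) + 1, by positivity, fun φ => ?_⟩
  obtain ⟨h, hh, hhm, hhn, hhp⟩ := exists_eq_wPair (hw := T.nonneg) (hp := hp) T.pos hpp
    (φ.toLinearMap ∘ₗ synthesis (hq := hq) T) (C := ‖φ‖ * C) (mul_nonneg (norm_nonneg _) hC)
    (fun t => (φ.le_opNorm _).trans (by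
      rw [mul_assoc]
      exact mul_le_mul_of_nonneg_left (hS t) (norm_nonneg _)))
  -- Synthesis erases the value at the root, so the pulled-back functional kills the point mass
  -- there.
  have hh0 : h o = 0 := by
    rw [hh o]
    have h1 : synthesis (hq := hq) (hp := hp) T (wTrunc T.nonneg hp {o} 1) = 0 := by
      refine Subtype.ext ?_
      rw [synthesis_coe]
      have h2 : eraseAt o (wTrunc T.nonneg hp {o} (1 : X → ℂ)).1 = 0 := by
        ext x
        by_cases hx : x = o
        · rw [hx, eraseAt_self]
          rfl
        · simp [eraseAt, wTrunc, hx]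
      rw [h2, map_zero, map_zero]
      rfl
    rw [LinearMap.comp_apply, h1, map_zero, zero_div]
  let s : BergmanSpace G o hq α hp' := synthesis T ⟨h, hhm⟩
  have hs : s.1 = G.ofInnovation o q (G.siblingProj o h) := by
    rw [synthesis_coe, eraseAt_of_eq_zero hh0]
  have hd0 : G.siblingProj o h o = 0 := by rw [SimpleGraph.siblingProj_root, hh0]
  have hsi : G.innovation o q (κ⁻¹ • s.1) = κ⁻¹ • G.siblingProj o h := by
    rw [map_smul, hs, T.tree.innovation_ofInnovation q hd0]
  -- The constant part is fixed by testing on 1, as `⟨1, 1⟩ = W`; the factor `κ⁻¹` cancels the `κ`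
  -- between pairings of functions and of innovations.
  refine ⟨(φ e / W) • e' + κ⁻¹ • s, ?_, ?_⟩
  · ext f
    let f₀ : BergmanSpace G o hq α hp := f - f.1 o • e
    have hf : f = f.1 o • e + f₀ := (add_sub_cancel _ _).symm
    have hf0 : f₀.1 o = 0 := by
      change f.1 o - f.1 o * 1 = 0
      ring
    have hfc := (T.isHarmonicFun_iff hf0).1 f₀.2.1
    have hd := T.wMem_innovation hp f₀.wMem
    have hdo : G.innovation o q f₀.1 o = 0 := by rw [SimpleGraph.innovation_root, hf0]
    -- The innovations of `f₀` already vanish at the root and have zero sibling sums, so erasing and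
    -- projecting leave them unchanged.
    have h1 : synthesis T ⟨G.innovation o q f₀.1, hd⟩ = f₀ := by
      refine Subtype.ext ?_
      rw [synthesis_coe, eraseAt_of_eq_zero hdo, SimpleGraph.siblingProj_of_sum_eq_zero hfc,
        T.tree.ofInnovation_innovation q hf0]
    have h2 : φ f₀ = wPair w (G.innovation o q f₀.1) h := by
      have := hhp ⟨G.innovation o q f₀.1, hd⟩
      rwa [LinearMap.comp_apply, h1] at this
    -- The projection changes `h` only by a shifted function, to which innovations of harmonic
    -- functions are orthogonal.
    have h3 : wPair w (G.innovation o q f₀.1) (G.siblingProj o h) =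
        wPair w (G.innovation o q f₀.1) h := by
      have hav := (T.wMem_childAverage hp' hhm hh0).1
      have h4 := hd.pair_add_right T.nonneg hpp (T.wMem_shift hp' hav).1
        (hhm.sub T.nonneg hp' (T.wMem_shift hp' hav).1).1
      rw [T.wPair_shift_eq_zero hpp hd hav hdo hfc, zero_add, add_sub_cancel] at h4
      rw [h4, SimpleGraph.siblingProj_eq]
    have hsm := s.wMem.smul T.nonneg hp' κ⁻¹
    have h5 := T.wPair_add_const hpp f₀.wMem hsm.1 hf0
      (by rw [Pi.smul_apply, hs, SimpleGraph.ofInnovation_root, smul_zero]) hfc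
      (by
        intro y
        simp only [hsi, Pi.smul_apply, ← Finset.smul_sum, T.sum_children_siblingProj, smul_zero])
      (f.1 o) (φ e / W)
    rw [hsi, wPair_smul_right, h3, ← h2] at h5
    have h6 : φ f = f.1 o * φ e + φ f₀ := by
      conv_lhs => rw [hf]
      rw [map_add, map_smul, smul_eq_mul]
    rw [h6, pairing_apply]
    have h7 : f.1 = f.1 o • 1 + f₀.1 := congrArg Subtype.val hf
    rw [h7]
    refine h5.trans ?_
    rw [← h7, ← mul_assoc κ, mul_inv_cancel₀ hκ, one_mul, mul_assoc, div_mul_cancel₀ _ hW]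
  · have h1 : ‖(φ e / W) • e'‖ ≤ ‖e‖ / ‖W‖ * ‖e'‖ * ‖φ‖ := by
      rw [norm_smul, norm_div]
      calc ‖φ e‖ / ‖W‖ * ‖e'‖ ≤ ‖φ‖ * ‖e‖ / ‖W‖ * ‖e'‖ := by
            gcongr
            exact φ.le_opNorm e
        _ = _ := by ring
    have h2 : ‖κ⁻¹ • s‖ ≤ ‖κ⁻¹‖ * (C' * C) * ‖φ‖ := by
      rw [norm_smul]
      have h3 : ‖s‖ ≤ C' * (‖φ‖ * C) :=
        (hS' _).trans (mul_le_mul_of_nonneg_left hhn hC')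
      calc _ ≤ ‖κ⁻¹‖ * (C' * (‖φ‖ * C)) := mul_le_mul_of_nonneg_left h3 (norm_nonneg _)
        _ = _ := by ring
    refine (norm_add_le _ _).trans ?_
    have h4 := norm_nonneg φ
    linarith

/-- By `exists_pairing_eq` with the exponents exchanged, every functional on the space of `g` is the
pairing with some `f`. If all these pairings vanish at `g`, then `g = 0` by Hahn–Banach. -/
theorem pairing_injective (hq : 2 ≤ q) (hp : 1 ≤ p) (hp' : 1 ≤ p')
    (T : TreeWeight G o q a (expWeight G o q α)) (hpp : p.HolderConjugate p') :
    Function.Injective (pairing hpp :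
      BergmanSpace G o hq α hp' →L[ℂ] StrongDual ℂ (BergmanSpace G o hq α hp)) := by
  rw [injective_iff_map_eq_zero]
  intro g hg
  refine SeparatingDual.eq_zero_of_forall_dual_eq_zero (R := ℂ) fun η => ?_
  obtain ⟨_, -, h⟩ := exists_pairing_eq hq hp' hp T hpp.symm
  obtain ⟨f, rfl, -⟩ := h η
  rw [pairing_apply, wPair_comm]
  exact DFunLike.congr_fun hg f

end BergmanSpace

end

theorem mainTheorem11 {X : Type*} (G : SimpleGraph X) [G.LocallyFinite] (hG : G.IsTree)
    (q : ℕ) (hq : 2 ≤ q) (hreg : G.IsRegularOfDegree (q + 1)) (o : X)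
    (α : ℝ) (hα : 1 < α) (p p' : ℝ) (hp : 1 < p) (hp' : 1 < p') (hpp' : 1 / p + 1 / p' = 1) :
    ∃ Ψ : BergmanSpace G o hq α hp'.le ≃ₗ[ℂ] StrongDual ℂ (BergmanSpace G o hq α hp.le),
      (∀ (g : BergmanSpace G o hq α hp'.le) (f : BergmanSpace G o hq α hp.le),
        HasSum (fun z => f z * g z * (expWeight G o q α z : ℂ)) (Ψ g f)) ∧
      ∃ c C : ℝ, 0 < c ∧ 0 < C ∧
        ∀ g : BergmanSpace G o hq α hp'.le, c * ‖g‖ ≤ ‖Ψ g‖ ∧ ‖Ψ g‖ ≤ C * ‖g‖ := by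
  have hpp : p.HolderConjugate p' :=
    Real.holderConjugate_iff.2 ⟨hp, by rwa [one_div, one_div] at hpp'⟩
  have T := treeWeight_expWeight hG hq hreg o hα
  obtain ⟨K, hK, h⟩ := BergmanSpace.exists_pairing_eq hq hp.le hp'.le T hpp
  have hinj := BergmanSpace.pairing_injective hq hp.le hp'.le T hpp
  refine ⟨LinearEquiv.ofBijective (BergmanSpace.pairing hpp).toLinearMap
    ⟨hinj, fun φ => (h φ).imp fun _ hg => hg.1⟩,
    fun g f => (f.wMem.hasSum_pair T.nonneg hpp g.wMem).2.1, K⁻¹, 1, inv_pos.2 hK, one_pos,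
    fun g => ⟨?_, ?_⟩⟩
  -- The norm-controlled preimage `g'` of the functional of `g` is `g` itself by injectivity, so the
  -- lower bound needs no open mapping theorem.
  · obtain ⟨g', hg', hn⟩ := h (BergmanSpace.pairing hpp g)
    rw [hinj hg'] at hn
    exact (inv_mul_le_iff₀ hK).2 hn
  · rw [one_mul]
    exact BergmanSpace.norm_pairing_le hpp g
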